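/- Let $D\subset\mathbb R^d$ be measurable, $\varrho_D$ a probability measure on $D$, and $H(K)$ a separable reproducing kernel Hilbert space of complex-valued functions on $D$ with reproducing kernel $K$, all of whose elements are ($\varrho_D$-almost everywhere) measurable, such that $$\|K\|_\infty:=\sup_{x\in D}\sqrt{K(x,x)}<\infty .$$ Let $\|\mathrm{Id}\|$ denote the operator norm of the embedding $\mathrm{Id}\colon H(K)\to L_2(D,\varrho_D)$. For $n\in\mathbb N$, $n\ge 1$, let the nodes $X=(x^1,\dots,x^n)\in D^n$ be drawn according to the product measure $\varrho_D^{\,n}$ (with probability denoted $\mathbb P$), and put $$E_n(X):=\sup_{\|f\|_{H(K)}\le 1}\Big|\int_D|f(x)|^2\,d\varrho_D(x)-\frac1n\sum_{i=1}^n|f(x^i)|^2\Big| .$$ (i) For all $n\ge 1$ and all $0<t\le 1$, $$\mathbb P\big(E_n(X)>t\,\|\mathrm{Id}\|^2\big)\le 2^{3/4}\,n\,\exp\Big(-\frac{n\,t^2\,\|\mathrm{Id}\|^2}{21\,\|K\|_\infty^2}\Big)$$ (the exponent is read as $0$ in the trivial case $K=0$). (ii) For all $r>1$ and all $n\ge 1$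 that are sufficiently large in the sense that $n/\log n\ge 21\,r\,\|K\|_\infty^2/\|\mathrm{Id}\|^2$, that is, $21\,r\,\|K\|_\infty^2\log n\le n\,\|\mathrm{Id}\|^2$, $$\mathbb P\Big(E_n(X)\le\|\mathrm{Id}\|\,\|K\|_\infty\sqrt{\frac{21\,r\log n}{n}}\Big)>1-2n^{1-r}.$$ -/

import Mathlib

open MeasureTheory

noncomputable section

namespace SamplingDiscretization

/-- The worst-case discretization error of the nodes `X = (x¹, …, xⁿ)`: the supremum over the unit
ball of `H(K)` of `|∫ |f|² dρ - (1/n) ∑ᵢ |f(xⁱ)|²|`. For a bounded kernel the family is bounded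
above, so this is a genuine supremum. -/
def discretizationError {D : Type*} (H : Type*) [NormedAddCommGroup H] [InnerProductSpace ℂ H]
    [RKHS ℂ H D ℂ] [MeasurableSpace D] (ρ : Measure D) {n : ℕ} (X : Fin n → D) : ℝ :=
  ⨆ f : Metric.closedBall (0 : H) 1,
    |(∫ x, ‖f.1 x‖ ^ 2 ∂ρ) - (1 / (n : ℝ)) * ∑ i, ‖f.1 (X i)‖ ^ 2|

variable {D : Type*} (H : Type*) [NormedAddCommGroup H] [InnerProductSpace ℂ H] [CompleteSpace H]
  [RKHS ℂ H D ℂ]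

/-- The reproducing kernel `K(x, y)` of a reproducing kernel Hilbert space of complex-valued
functions on `D`, as a complex number (Mathlib's `RKHS.kernel` is operator-valued). -/
def kernel (x y : D) : ℂ := RKHS.kernel H x y 1

/-- The kernel is bounded: `x ↦ √K(x, x)` is bounded above on `D`
(`K(x, x)` is a nonnegative real number). -/
def BoundedKernel : Prop := BddAbove (Set.range fun x : D => √(kernel H x x).re)

/-- `‖K‖_∞ = sup_{x ∈ D} √K(x, x)`. -/
def kernelSup : ℝ := ⨆ x : D, √(kernel H x x).re

variable {H}

/-- The reproducing property `f(y) = ⟨f, K(·, y)⟩` gives `|f(y)| ≤ ‖f‖ √K(y, y)`. -/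
theorem norm_apply_le_sqrt_kernel (f : H) (x : D) : ‖f x‖ ≤ ‖f‖ * √(kernel H x x).re := by
  have h1 : RKHS.kernel H x x (1 : ℂ) = inner ℂ (RKHS.kerFun H x (1 : ℂ)) (RKHS.kerFun H x 1) := by
    rw [RKHS.kerFun_inner, RKHS.kerFun_apply]
    simp
  have h2 : √(kernel H x x).re = ‖RKHS.kerFun H x (1 : ℂ)‖ := by
    rw [kernel, h1, ← RCLike.re_eq_complex_re, inner_self_eq_norm_sq, Real.sqrt_sq (norm_nonneg _)]
  have h3 : f x = inner ℂ (RKHS.kerFun H x (1 : ℂ)) f := by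
    rw [RKHS.kerFun_inner]
    simp
  rw [h2, h3, mul_comm]
  exact norm_inner_le_norm _ _

theorem norm_apply_le_kernelSup (hK : BoundedKernel H) (f : H) (x : D) :
    ‖f x‖ ≤ kernelSup H * ‖f‖ := by
  refine (norm_apply_le_sqrt_kernel f x).trans ?_
  rw [mul_comm]
  exact mul_le_mul_of_nonneg_right (le_ciSup hK x) (norm_nonneg _)

theorem kernelSup_nonneg : 0 ≤ kernelSup H := Real.iSup_nonneg fun _ => Real.sqrt_nonneg _

variable [MeasurableSpace D] (ρ : Measure D) [IsProbabilityMeasure ρ]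

theorem memLp_two (hmeas : ∀ f : H, AEStronglyMeasurable (fun x => f x) ρ)
    (hK : BoundedKernel H) (f : H) : MemLp (fun x => f x) 2 ρ :=
  MemLp.of_bound (hmeas f) (kernelSup H * ‖f‖)
    (Filter.Eventually.of_forall (norm_apply_le_kernelSup hK f))

/-- The embedding `Id : H(K) → L₂(D, ρ)`, `f ↦ [f]`, as a bounded operator; its operator norm
is `‖Id‖_{K,2}`. -/
def embedding (hmeas : ∀ f : H, AEStronglyMeasurable (fun x => f x) ρ) (hK : BoundedKernel H) :
    H →L[ℂ] Lp ℂ 2 ρ :=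
  LinearMap.mkContinuous
    { toFun := fun f => (memLp_two ρ hmeas hK f).toLp (fun x => f x)
      map_add' := fun f g => by
        rw [← MemLp.toLp_add]
        exact MemLp.toLp_congr _ _ (Filter.Eventually.of_forall fun x => by simp)
      map_smul' := fun c f => by
        rw [RingHom.id_apply, ← MemLp.toLp_const_smul]
        exact MemLp.toLp_congr _ _ (Filter.Eventually.of_forall fun x => by simp) }
    (kernelSup H) (fun f => by
      have h := Lp.norm_le_of_ae_bound (p := 2) (μ := ρ)
        (f := (memLp_two ρ hmeas hK f).toLp (fun x => f x))
        (mul_nonneg (kernelSup_nonneg (H := H)) (norm_nonneg f)) (by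
          filter_upwards [(memLp_two ρ hmeas hK f).coeFn_toLp] with x hx
          rw [hx]
          exact norm_apply_le_kernelSup hK f x)
      simpa [measureUnivNNReal] using h)

end SamplingDiscretization

end

/-!
The discretization error is the operator norm of a centered sum `D = ∑ᵢ (aᵢ - T)` of independent
positive semidefinite rank-one operators, divided by `n`: here `a(x)` is the quadratic form
`f ↦ |f(x)|²` on `H(K)` and `T` is its mean, so that `a² ≤ B a` and `T ≤ l`, where `B = ‖K‖_∞²` and
`l = ‖Id‖²`. Compressing to a finite-dimensional subspace turns all of these into matrices, with
the same `B` and `l`; the bounds below are free of the dimension, and separability gives the whole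
space by an increasing union of events (`measureReal_lt_discretizationError_le`).

The matrix statement `measureReal_exists_lt_le` comes from the Laplace transform
`F(θ) = 𝔼 tr (cosh (θ D) - 1)`, through Markov's inequality. Its derivative is
`𝔼 tr (D sinh (θ D)) = ∑ᵢ 𝔼 tr (Zᵢ (sinh (θ D) - sinh (θ (D - Zᵢ))))` with `Zᵢ = aᵢ - T`, because
`Zᵢ` is centered and independent of `D - Zᵢ`. The trace of a product `f(X) g(Y)` of functions of two
Hermitian matrices is a nonnegative combination of the numbers `f(x) g(y)`, `x` and `y` being
eigenvalues (`reTrace_conjDiag_mul`), so scalar inequalities in two variables become trace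
inequalities. The trapezoidal bound `(x - y)(sinh x - sinh y) ≤ (x - y)² (cosh x + cosh y) / 2`
introduces `Zᵢ² ≤ 2 aᵢ² + 2 T² ≤ 2 B (Zᵢ + 2 T)`, and convexity of `cosh` compares `D - Zᵢ` with
`D`. The outcome is the differential inequality `F' ≤ θ B F' + 4 n B θ (l F + tr T)`
(`sinhTrace_le`), and integrating it gives `l F + tr T ≤ tr T · exp (5 n B l θ² / 2)` as long as
`5 θ B ≤ 1`.

Since `tr T ≤ B`, the role of the dimension is played by `B / l`, which is at most a multiple of `n`
as soon as the claimed bound is smaller than `1`. The choice `θ = t / (5 B)` leaves the exponent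
`n t² l / (10 B)`, which is better than the required `n t² l / (21 B)`.
-/

open MeasureTheory

noncomputable section

namespace SamplingDiscretization

open NormedSpace (exp)
open scoped ComplexOrder Matrix Matrix.Norms.Operator

/-! ### Hermitian matrices in an eigenbasis -/

section Spectral

variable {ι : Type*} [Fintype ι]

/-- The real part of the trace, as a real-linear functional. -/
def reTrace : Matrix ι ι ℂ →ₗ[ℝ] ℝ := Complex.reLm ∘ₗ Matrix.traceLinearMap ι ℝ ℂ

theorem reTrace_apply (A : Matrix ι ι ℂ) : reTrace A = A.trace.re := rfl

theorem reTrace_mul_comm (A B : Matrix ι ι ℂ) : reTrace (A * B) = reTrace (B * A) := by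
  rw [reTrace_apply, Matrix.trace_mul_comm, reTrace_apply]

theorem continuous_reTrace : Continuous (reTrace : Matrix ι ι ℂ → ℝ) :=
  LinearMap.continuous_of_finiteDimensional _

variable [DecidableEq ι]

/-- Hyperbolic cosine of a square matrix. -/
def matCosh (A : Matrix ι ι ℂ) : Matrix ι ι ℂ := (2⁻¹ : ℝ) • (exp A + exp (-A))

/-- Hyperbolic sine of a square matrix. -/
def matSinh (A : Matrix ι ι ℂ) : Matrix ι ι ℂ := (2⁻¹ : ℝ) • (exp A - exp (-A))

theorem continuous_matCosh : Continuous (matCosh : Matrix ι ι ℂ → Matrix ι ι ℂ) := by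
  have h := NormedSpace.exp_continuous (𝔸 := Matrix ι ι ℂ)
  exact ((h.add (h.comp continuous_neg)).const_smul (2⁻¹ : ℝ))

theorem continuous_matSinh : Continuous (matSinh : Matrix ι ι ℂ → Matrix ι ι ℂ) := by
  have h := NormedSpace.exp_continuous (𝔸 := Matrix ι ι ℂ)
  exact ((h.sub (h.comp continuous_neg)).const_smul (2⁻¹ : ℝ))

theorem hasDerivAt_reTrace_matCosh (A : Matrix ι ι ℂ) (θ : ℝ) :
    HasDerivAt (fun s : ℝ => reTrace (matCosh (s • A))) (reTrace (A * matSinh (θ • A))) θ := by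
  have h1 := hasDerivAt_exp_smul_const' (𝕂 := ℝ) A θ
  have h2 := hasDerivAt_exp_smul_const' (𝕂 := ℝ) (-A) θ
  have h3 := (h1.add h2).const_smul (2⁻¹ : ℝ)
  have h4 := (LinearMap.toContinuousLinearMap (reTrace (ι := ι))).hasFDerivAt.comp_hasDerivAt θ h3
  refine (h4.congr_deriv ?_).congr_of_eventuallyEq (Filter.Eventually.of_forall fun s => ?_)
  · change reTrace ((2⁻¹ : ℝ) • (A * exp (θ • A) + -A * exp (θ • -A))) = _
    rw [matSinh, mul_smul_comm, mul_sub, neg_mul, smul_neg, ← sub_eq_add_neg]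
  · change reTrace ((2⁻¹ : ℝ) • (exp (s • A) + exp (-(s • A)))) =
      reTrace ((2⁻¹ : ℝ) • (exp (s • A) + exp (s • -A)))
    rw [smul_neg]

/-- The Hermitian matrix with eigenvalues `d` in the orthonormal basis of the columns of `U`. -/
def conjDiag (U : Matrix.unitaryGroup ι ℂ) (d : ι → ℝ) : Matrix ι ι ℂ :=
  (U : Matrix ι ι ℂ) * Matrix.diagonal (fun i => (d i : ℂ)) * star (U : Matrix ι ι ℂ)

theorem conjDiag_mul (U : Matrix.unitaryGroup ι ℂ) (d e : ι → ℝ) :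
    conjDiag U d * conjDiag U e = conjDiag U (d * e) := by
  have h : star (U : Matrix ι ι ℂ) * (U : Matrix ι ι ℂ) = 1 := Unitary.coe_star_mul_self U
  calc conjDiag U d * conjDiag U e
      = (U : Matrix ι ι ℂ) * Matrix.diagonal (fun i => (d i : ℂ)) *
          (star (U : Matrix ι ι ℂ) * (U : Matrix ι ι ℂ)) *
          Matrix.diagonal (fun i => (e i : ℂ)) * star (U : Matrix ι ι ℂ) := by
        simp only [conjDiag, mul_assoc]
    _ = conjDiag U (d * e) := by
        rw [h, mul_one, mul_assoc (U : Matrix ι ι ℂ), Matrix.diagonal_mul_diagonal]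
        simp [conjDiag]

theorem conjDiag_one (U : Matrix.unitaryGroup ι ℂ) : conjDiag U 1 = 1 := by
  simp [conjDiag]

theorem conjDiag_add (U : Matrix.unitaryGroup ι ℂ) (d e : ι → ℝ) :
    conjDiag U d + conjDiag U e = conjDiag U (d + e) := by
  simp only [conjDiag, ← add_mul, ← mul_add, Matrix.diagonal_add]
  simp

theorem conjDiag_smul (U : Matrix.unitaryGroup ι ℂ) (c : ℝ) (d : ι → ℝ) :
    c • conjDiag U d = conjDiag U (c • d) := by
  have : Matrix.diagonal (fun i => (((c • d) i : ℝ) : ℂ)) =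
      c • Matrix.diagonal (fun i => (d i : ℂ)) := by
    ext i j
    by_cases h : i = j
    · subst h; simp
    · simp [h]
  rw [conjDiag, conjDiag, this, mul_smul_comm, smul_mul_assoc]

theorem conjDiag_sub (U : Matrix.unitaryGroup ι ℂ) (d e : ι → ℝ) :
    conjDiag U d - conjDiag U e = conjDiag U (d - e) := by
  have h := conjDiag_smul U (-1) e
  have h2 := conjDiag_add U d ((-1 : ℝ) • e)
  rw [← h] at h2
  simpa [sub_eq_add_neg] using h2

theorem exp_conjDiag (U : Matrix.unitaryGroup ι ℂ) (d : ι → ℝ) :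
    exp (conjDiag U d) = conjDiag U (fun i => Real.exp (d i)) := by
  have hU : (U : Matrix ι ι ℂ)⁻¹ = star (U : Matrix ι ι ℂ) :=
    Matrix.inv_eq_left_inv (Unitary.coe_star_mul_self U)
  have hu : IsUnit (U : Matrix ι ι ℂ) := (Unitary.toUnits U).isUnit
  rw [conjDiag, ← hU, Matrix.exp_conj _ _ hu, Matrix.exp_diagonal, hU, conjDiag]
  congr 3
  ext i
  simp [NormedSpace.exp_eq_tsum_div, Complex.exp_eq_exp_ℂ]

theorem matCosh_conjDiag (U : Matrix.unitaryGroup ι ℂ) (d : ι → ℝ) :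
    matCosh (conjDiag U d) = conjDiag U (fun i => Real.cosh (d i)) := by
  have h := conjDiag_smul U (-1) d
  rw [neg_one_smul] at h
  rw [matCosh, h, exp_conjDiag, exp_conjDiag, conjDiag_add, conjDiag_smul]
  congr 1
  ext i
  simp [Real.cosh_eq]
  ring

theorem matSinh_conjDiag (U : Matrix.unitaryGroup ι ℂ) (d : ι → ℝ) :
    matSinh (conjDiag U d) = conjDiag U (fun i => Real.sinh (d i)) := by
  have h := conjDiag_smul U (-1) d
  rw [neg_one_smul] at h
  rw [matSinh, h, exp_conjDiag, exp_conjDiag, conjDiag_sub, conjDiag_smul]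
  congr 1
  ext i
  simp [Real.sinh_eq]
  ring

theorem _root_.Matrix.IsHermitian.exists_conjDiag {A : Matrix ι ι ℂ} (hA : A.IsHermitian) :
    ∃ U d, A = conjDiag U d :=
  ⟨hA.eigenvectorUnitary, hA.eigenvalues, by
    conv_lhs => rw [hA.spectral_theorem]
    simp [Unitary.conjStarAlgAut_apply, conjDiag, Function.comp_def]⟩

theorem posSemidef_conjDiag (U : Matrix.unitaryGroup ι ℂ) {d : ι → ℝ} (hd : ∀ i, 0 ≤ d i) :
    (conjDiag U d).PosSemidef := by
  have h : (Matrix.diagonal (fun i => (d i : ℂ))).PosSemidef :=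
    Matrix.PosSemidef.diagonal fun i => by simpa using hd i
  exact h.mul_mul_conjTranspose_same (U : Matrix ι ι ℂ)

/-- The trace of a product of two Hermitian matrices is a double sum over pairs of eigenvalues
with nonnegative weights `|⟨uᵢ, wⱼ⟩|²`. Scalar inequalities in two variables therefore pass to
traces of products of functions of two non-commuting Hermitian matrices. -/
theorem reTrace_conjDiag_mul (U V : Matrix.unitaryGroup ι ℂ) (d e : ι → ℝ) :
    reTrace (conjDiag U d * conjDiag V e) =
      ∑ i, ∑ j, d i * e j * ‖(star (U : Matrix ι ι ℂ) * (V : Matrix ι ι ℂ)) i j‖ ^ 2 := by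
  set W := star (U : Matrix ι ι ℂ) * (V : Matrix ι ι ℂ) with hW
  have h : reTrace (conjDiag U d * conjDiag V e) =
      reTrace (Matrix.diagonal (fun i => (d i : ℂ)) * W * Matrix.diagonal (fun i => (e i : ℂ)) *
        star W) := by
    rw [show conjDiag U d * conjDiag V e = (U : Matrix ι ι ℂ) *
      (Matrix.diagonal (fun i => (d i : ℂ)) * W * Matrix.diagonal (fun i => (e i : ℂ)) *
        star (V : Matrix ι ι ℂ)) by simp only [conjDiag, hW, mul_assoc], reTrace_mul_comm]
    simp only [hW, star_mul, star_star, mul_assoc]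
  rw [h, reTrace_apply, Matrix.trace, Complex.re_sum]
  refine Finset.sum_congr rfl fun i _ => ?_
  rw [Matrix.diag_apply, Matrix.mul_apply, Complex.re_sum]
  refine Finset.sum_congr rfl fun j _ => ?_
  rw [Matrix.mul_diagonal, Matrix.diagonal_mul, Matrix.star_apply]
  have : (d i : ℂ) * W i j * (e j : ℂ) * star (W i j) =
      ((d i * e j * ‖W i j‖ ^ 2 : ℝ) : ℂ) := by
    have h2 : W i j * star (W i j) = ((‖W i j‖ ^ 2 : ℝ) : ℂ) := by
      rw [Complex.star_def, Complex.mul_conj, Complex.normSq_eq_norm_sq]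
    push_cast at h2 ⊢
    rw [← h2]; ring
  rw [this, Complex.ofReal_re]

end Spectral

/-! ### Scalar inequalities for hyperbolic functions -/

theorem mul_sinh_le_sq_mul_cosh (h : ℝ) : h * Real.sinh h ≤ h ^ 2 * Real.cosh h := by
  have key : ∀ x : ℝ, 0 ≤ x → Real.sinh x ≤ x * Real.cosh x := by
    have hm : MonotoneOn (fun x : ℝ => x * Real.cosh x - Real.sinh x) (Set.Ici 0) := by
      have hd : ∀ x : ℝ, HasDerivAt (fun x : ℝ => x * Real.cosh x - Real.sinh x)
          (x * Real.sinh x) x := fun x => by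
        have := ((hasDerivAt_id x).mul (Real.hasDerivAt_cosh x)).sub (Real.hasDerivAt_sinh x)
        refine this.congr_deriv ?_
        simp
      refine monotoneOn_of_deriv_nonneg (convex_Ici 0)
        (fun x _ => (hd x).continuousAt.continuousWithinAt)
        (fun x _ => (hd x).differentiableAt.differentiableWithinAt) fun x hx => ?_
      rw [interior_Ici, Set.mem_Ioi] at hx
      rw [(hd x).deriv]
      exact mul_nonneg hx.le (Real.sinh_nonneg_iff.2 hx.le)
    intro x hx
    have := hm (Set.mem_Ici.2 le_rfl) (Set.mem_Ici.2 hx) hx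
    simp only [zero_mul, Real.sinh_zero, sub_zero] at this
    linarith
  rcases le_total 0 h with h0 | h0
  · nlinarith [key h h0]
  · have := key (-h) (by linarith)
    rw [Real.sinh_neg, Real.cosh_neg] at this
    nlinarith

/-- The trapezoidal rule overestimates `∫ cosh` between `y` and `x`. -/
theorem sub_mul_sinh_sub_sinh_le (x y : ℝ) :
    (x - y) * (Real.sinh x - Real.sinh y) ≤
      (x - y) ^ 2 * (Real.cosh x + Real.cosh y) / 2 := by
  obtain ⟨u, h, rfl, rfl⟩ : ∃ u h : ℝ, x = u + h ∧ y = u - h :=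
    ⟨(x + y) / 2, (x - y) / 2, by ring, by ring⟩
  rw [Real.sinh_add, Real.sinh_sub, Real.cosh_add, Real.cosh_sub]
  nlinarith [mul_le_mul_of_nonneg_left (mul_sinh_le_sq_mul_cosh h) (Real.cosh_pos u).le]

theorem cosh_add_mul_sinh_le (x y : ℝ) :
    Real.cosh y + (x - y) * Real.sinh y ≤ Real.cosh x := by
  have h1 : Real.exp y * (1 + (x - y)) ≤ Real.exp x := by
    have := Real.add_one_le_exp (x - y)
    calc Real.exp y * (1 + (x - y)) ≤ Real.exp y * Real.exp (x - y) := by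
          gcongr; linarith
      _ = Real.exp x := by rw [← Real.exp_add]; congr 1; ring
  have h2 : Real.exp (-y) * (1 - (x - y)) ≤ Real.exp (-x) := by
    have := Real.add_one_le_exp (-(x - y))
    calc Real.exp (-y) * (1 - (x - y)) ≤ Real.exp (-y) * Real.exp (-(x - y)) := by
          gcongr; linarith
      _ = Real.exp (-x) := by rw [← Real.exp_add]; congr 1; ring
  rw [Real.cosh_eq, Real.sinh_eq, Real.cosh_eq]
  linarith

theorem mul_cosh_sub_one_le {θ : ℝ} (hθ : 0 ≤ θ) (x : ℝ) :
    x * (Real.cosh (θ * x) - 1) ≤ x * Real.sinh (θ * x) := by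
  have h1 := Real.one_le_cosh (θ * x)
  rcases le_total 0 x with hx | hx
  · have h2 : Real.exp (-(θ * x)) ≤ 1 := Real.exp_le_one_iff.2 (by nlinarith [mul_nonneg hθ hx])
    rw [← Real.cosh_sub_sinh] at h2
    exact mul_le_mul_of_nonneg_left (by linarith) hx
  · have h2 : Real.sinh (θ * x) ≤ 0 :=
      Real.sinh_nonpos_iff.2 (mul_nonpos_of_nonneg_of_nonpos hθ hx)
    exact (mul_nonpos_of_nonpos_of_nonneg hx (by linarith)).trans
      (mul_nonneg_of_nonpos_of_nonpos hx h2)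

/-! ### Trace inequalities -/

section TraceInequalities

variable {ι : Type*} [Fintype ι]

theorem reTrace_sq_mul_nonneg {A C : Matrix ι ι ℂ} (hA : A.IsHermitian) (hC : C.PosSemidef) :
    0 ≤ reTrace (A * A * C) := by
  have h := (hC.conjTranspose_mul_mul_same A).trace_nonneg
  rw [hA.eq] at h
  rw [mul_assoc, reTrace_mul_comm]
  exact (Complex.le_def.1 h).1

theorem reTrace_sub_sq_mul_le {A B C : Matrix ι ι ℂ} (hA : A.IsHermitian) (hB : B.IsHermitian)
    (hC : C.PosSemidef) :
    reTrace ((A - B) * (A - B) * C) ≤ 2 * reTrace (A * A * C) + 2 * reTrace (B * B * C) := by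
  have h := reTrace_sq_mul_nonneg (hA.add hB) hC
  simp only [add_mul, mul_add, sub_mul, mul_sub, map_add, map_sub] at h ⊢
  linarith

variable [DecidableEq ι]

theorem reTrace_conjDiag (U : Matrix.unitaryGroup ι ℂ) (d : ι → ℝ) :
    reTrace (conjDiag U d) = ∑ i, d i := by
  have h : star (U : Matrix ι ι ℂ) * (U : Matrix ι ι ℂ) = 1 := Unitary.coe_star_mul_self U
  rw [conjDiag, reTrace_mul_comm, ← mul_assoc, h, one_mul, reTrace_apply, Matrix.trace_diagonal]
  simp

theorem reTrace_mul_nonneg {P Q : Matrix ι ι ℂ} (hP : P.PosSemidef) (hQ : Q.PosSemidef) :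
    0 ≤ reTrace (P * Q) := by
  obtain ⟨U, d, hd, rfl⟩ : ∃ U d, (∀ i, 0 ≤ d i) ∧ Q = conjDiag U d := by
    refine ⟨hQ.1.eigenvectorUnitary, hQ.1.eigenvalues, hQ.eigenvalues_nonneg, ?_⟩
    conv_lhs => rw [hQ.1.spectral_theorem]
    simp [Unitary.conjStarAlgAut_apply, conjDiag, Function.comp_def]
  have hsq : (fun i => √(d i)) * (fun i => √(d i)) = d := funext fun i => Real.mul_self_sqrt (hd i)
  have hB := (posSemidef_conjDiag U (d := fun i => √(d i)) fun i => Real.sqrt_nonneg _).1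
  have h := (hP.conjTranspose_mul_mul_same (conjDiag U fun i => √(d i))).trace_nonneg
  rw [hB.eq] at h
  rw [← hsq, ← conjDiag_mul, ← mul_assoc, reTrace_mul_comm, ← mul_assoc]
  exact (Complex.le_def.1 h).1

theorem posSemidef_matCosh {A : Matrix ι ι ℂ} (hA : A.IsHermitian) :
    (matCosh A).PosSemidef := by
  obtain ⟨U, d, rfl⟩ := hA.exists_conjDiag
  rw [matCosh_conjDiag]
  exact posSemidef_conjDiag U fun i => (Real.cosh_pos _).le

theorem posSemidef_matCosh_sub_one {A : Matrix ι ι ℂ} (hA : A.IsHermitian) :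
    (matCosh A - 1).PosSemidef := by
  obtain ⟨U, d, rfl⟩ := hA.exists_conjDiag
  rw [matCosh_conjDiag, ← conjDiag_one U, conjDiag_sub]
  exact posSemidef_conjDiag U fun i => sub_nonneg.2 (Real.one_le_cosh _)

theorem reTrace_mul_matCosh_sub_one_le {A : Matrix ι ι ℂ} (hA : A.IsHermitian) {θ : ℝ}
    (hθ : 0 ≤ θ) :
    reTrace (A * (matCosh (θ • A) - 1)) ≤ reTrace (A * matSinh (θ • A)) := by
  obtain ⟨U, d, rfl⟩ := hA.exists_conjDiag
  rw [conjDiag_smul, matCosh_conjDiag, matSinh_conjDiag, ← conjDiag_one U, conjDiag_sub,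
    conjDiag_mul, conjDiag_mul, reTrace_conjDiag, reTrace_conjDiag]
  exact Finset.sum_le_sum fun i _ => mul_cosh_sub_one_le hθ (d i)

/-- Trace version of `sub_mul_sinh_sub_sinh_le`, for matrices that need not commute. -/
theorem reTrace_sub_mul_matSinh_sub_le {A B : Matrix ι ι ℂ} (hA : A.IsHermitian)
    (hB : B.IsHermitian) :
    reTrace ((A - B) * (matSinh A - matSinh B)) ≤
      reTrace ((A - B) * (A - B) * (matCosh A + matCosh B)) / 2 := by
  obtain ⟨U, x, rfl⟩ := hA.exists_conjDiag
  obtain ⟨V, y, rfl⟩ := hB.exists_conjDiag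
  rw [matSinh_conjDiag, matSinh_conjDiag, matCosh_conjDiag, matCosh_conjDiag]
  have hL : ∀ f g : ι → ℝ, reTrace ((conjDiag U x - conjDiag V y) *
      (conjDiag U f - conjDiag V g)) = ∑ i, ∑ j, (x i - y j) * (f i - g j) *
        ‖(star (U : Matrix ι ι ℂ) * (V : Matrix ι ι ℂ)) i j‖ ^ 2 := fun f g => by
    have h1 := reTrace_conjDiag_mul U V (x * f) 1
    have h2 := reTrace_conjDiag_mul U V 1 (y * g)
    have h3 := reTrace_conjDiag_mul U V x g
    have h4 := reTrace_conjDiag_mul U V f y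
    rw [conjDiag_one, mul_one, ← conjDiag_mul] at h1
    rw [conjDiag_one, one_mul, ← conjDiag_mul] at h2
    simp only [sub_mul, mul_sub, map_sub]
    rw [reTrace_mul_comm (conjDiag V y) (conjDiag U f), h1, h2, h3, h4]
    simp only [← Finset.sum_sub_distrib]
    refine Finset.sum_congr rfl fun i _ => Finset.sum_congr rfl fun j _ => ?_
    simp only [Pi.mul_apply, Pi.one_apply]
    ring
  have hR : ∀ f g : ι → ℝ, reTrace ((conjDiag U x - conjDiag V y) *
      (conjDiag U x - conjDiag V y) * (conjDiag U f + conjDiag V g)) =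
      ∑ i, ∑ j, (x i - y j) ^ 2 * (f i + g j) *
        ‖(star (U : Matrix ι ι ℂ) * (V : Matrix ι ι ℂ)) i j‖ ^ 2 := fun f g => by
    have a1 := reTrace_conjDiag_mul U V (x * x * f) 1
    have a2 := reTrace_conjDiag_mul U V (x * f) y
    have a3 := reTrace_conjDiag_mul U V f (y * y)
    have b1 := reTrace_conjDiag_mul U V (x * x) g
    have b2 := reTrace_conjDiag_mul U V x (y * g)
    have b3 := reTrace_conjDiag_mul U V 1 (y * y * g)
    have c1 : x * f = f * x := mul_comm _ _
    have c2 : y * g = g * y := mul_comm _ _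
    have p1 : reTrace (conjDiag U x * conjDiag V y * conjDiag U f) =
        reTrace (conjDiag U (x * f) * conjDiag V y) := by
      rw [reTrace_mul_comm, ← mul_assoc, conjDiag_mul, c1]
    have p2 : reTrace (conjDiag V y * conjDiag U x * conjDiag U f) =
        reTrace (conjDiag U (x * f) * conjDiag V y) := by
      rw [mul_assoc, reTrace_mul_comm, conjDiag_mul]
    have p3 : reTrace (conjDiag V y * conjDiag V y * conjDiag U f) =
        reTrace (conjDiag U f * conjDiag V (y * y)) := by
      rw [reTrace_mul_comm, conjDiag_mul]
    have q2 : reTrace (conjDiag U x * conjDiag V y * conjDiag V g) =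
        reTrace (conjDiag U x * conjDiag V (y * g)) := by
      rw [mul_assoc, conjDiag_mul]
    have q3 : reTrace (conjDiag V y * conjDiag U x * conjDiag V g) =
        reTrace (conjDiag U x * conjDiag V (y * g)) := by
      rw [mul_assoc, reTrace_mul_comm, mul_assoc, conjDiag_mul, c2]
    rw [conjDiag_one, mul_one, ← conjDiag_mul, ← conjDiag_mul] at a1
    rw [conjDiag_one, one_mul, ← conjDiag_mul, ← conjDiag_mul] at b3
    rw [← conjDiag_mul U x x] at b1
    simp only [sub_mul, mul_sub, mul_add, map_sub, map_add]
    rw [p1, p2, p3, q2, q3, a1, a2, a3, b1, b2, b3]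
    simp only [← Finset.sum_sub_distrib, ← Finset.sum_add_distrib]
    refine Finset.sum_congr rfl fun i _ => Finset.sum_congr rfl fun j _ => ?_
    simp only [Pi.mul_apply, Pi.one_apply]
    ring
  rw [hL, hR, Finset.sum_div]
  refine Finset.sum_le_sum fun i _ => ?_
  rw [Finset.sum_div]
  refine Finset.sum_le_sum fun j _ => ?_
  have := mul_le_mul_of_nonneg_right (sub_mul_sinh_sub_sinh_le (x i) (y j))
    (sq_nonneg ‖(star (U : Matrix ι ι ℂ) * (V : Matrix ι ι ℂ)) i j‖)
  linarith

/-- Klein's inequality for `cosh`. -/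
theorem reTrace_matCosh_add_le {A B : Matrix ι ι ℂ} (hA : A.IsHermitian)
    (hB : B.IsHermitian) :
    reTrace (matCosh B) + reTrace ((A - B) * matSinh B) ≤ reTrace (matCosh A) := by
  obtain ⟨U, x, rfl⟩ := hA.exists_conjDiag
  obtain ⟨V, y, rfl⟩ := hB.exists_conjDiag
  rw [matSinh_conjDiag, matCosh_conjDiag, matCosh_conjDiag, sub_mul, map_sub, conjDiag_mul]
  have h1 := reTrace_conjDiag_mul U V 1 (fun i => Real.cosh (y i))
  have h2 := reTrace_conjDiag_mul U V x (fun i => Real.sinh (y i))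
  have h3 := reTrace_conjDiag_mul U V 1 (y * fun i => Real.sinh (y i))
  have h4 := reTrace_conjDiag_mul U V (fun i => Real.cosh (x i)) 1
  rw [conjDiag_one, one_mul] at h1 h3
  rw [conjDiag_one, mul_one] at h4
  rw [h1, h2, h3, h4]
  simp only [← Finset.sum_sub_distrib, ← Finset.sum_add_distrib]
  refine Finset.sum_le_sum fun i _ => Finset.sum_le_sum fun j _ => ?_
  simp only [Pi.mul_apply, Pi.one_apply]
  have := mul_le_mul_of_nonneg_right (cosh_add_mul_sinh_le (x i) (y j))
    (sq_nonneg ‖(star (U : Matrix ι ι ℂ) * (V : Matrix ι ι ℂ)) i j‖)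
  linarith

/-- If the quadratic form of a Hermitian matrix is somewhere larger than `s` in absolute value,
then some eigenvalue is, and it alone contributes `cosh (θ s) - 1` to the trace. -/
theorem cosh_sub_one_le_reTrace {A : Matrix ι ι ℂ} (hA : A.IsHermitian) {s : ℝ} (θ : ℝ)
    (hs : 0 ≤ s) (c : ι → ℂ)
    (hc : s * (star c ⬝ᵥ c).re < |(star c ⬝ᵥ A *ᵥ c).re|) :
    Real.cosh (θ * s) - 1 ≤ reTrace (matCosh (θ • A) - 1) := by
  obtain ⟨U, d, rfl⟩ := hA.exists_conjDiag
  have hex : ∃ i, s ≤ |d i| := by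
    by_contra! hlt
    have key : ∀ ε : ℝ, |ε| = 1 →
        0 ≤ s * (star c ⬝ᵥ c).re + ε * (star c ⬝ᵥ conjDiag U d *ᵥ c).re := fun ε hε => by
      have h1 : (conjDiag U (s • (1 : ι → ℝ) + ε • d)).PosSemidef :=
        posSemidef_conjDiag U fun i => by
          have h2 : |ε * d i| ≤ s := by rw [abs_mul, hε, one_mul]; exact (hlt i).le
          simpa using by linarith [neg_abs_le (ε * d i)]
      have h2 := (Complex.le_def.1 (h1.dotProduct_mulVec_nonneg c)).1
      rw [← conjDiag_add, ← conjDiag_smul, ← conjDiag_smul, conjDiag_one, Matrix.add_mulVec,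
        Matrix.smul_mulVec, Matrix.smul_mulVec, Matrix.one_mulVec, dotProduct_add,
        dotProduct_smul, dotProduct_smul] at h2
      simpa using h2
    have k1 := key 1 (by simp)
    have k2 := key (-1) (by simp)
    exact absurd hc (not_lt.2 (abs_le.2 ⟨by linarith, by linarith⟩))
  obtain ⟨i, hi⟩ := hex
  rw [conjDiag_smul, matCosh_conjDiag, ← conjDiag_one U, conjDiag_sub, reTrace_conjDiag]
  have h1 : Real.cosh (θ * s) - 1 ≤ Real.cosh (θ * d i) - 1 := by
    refine sub_le_sub_right (Real.cosh_le_cosh.2 ?_) 1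
    rw [abs_mul, abs_mul, abs_of_nonneg hs]
    exact mul_le_mul_of_nonneg_left hi (abs_nonneg θ)
  refine h1.trans ?_
  exact Finset.single_le_sum (f := fun i => Real.cosh (θ * d i) - 1)
    (fun j _ => sub_nonneg.2 (Real.one_le_cosh _)) (Finset.mem_univ i)

end TraceInequalities

/-! ### Rank-one matrices and their mean -/

section Outer

variable {ι : Type*}

/-- The rank-one positive semidefinite matrix `z z*`. -/
def outer (z : ι → ℂ) : Matrix ι ι ℂ := Matrix.vecMulVec z (star z)

theorem continuous_outer : Continuous (outer : (ι → ℂ) → Matrix ι ι ℂ) :=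
  continuous_id.matrix_vecMulVec continuous_star

variable [Fintype ι]

theorem posSemidef_outer (z : ι → ℂ) : (outer z).PosSemidef :=
  Matrix.posSemidef_vecMulVec_self_star z

theorem star_dotProduct_self_re (z : ι → ℂ) : (star z ⬝ᵥ z).re = ∑ j, ‖z j‖ ^ 2 := by
  rw [dotProduct, Complex.re_sum]
  refine Finset.sum_congr rfl fun j _ => ?_
  rw [Pi.star_apply, Complex.star_def, Complex.conj_mul', ← Complex.ofReal_pow, Complex.ofReal_re]

theorem outer_mul_outer (z : ι → ℂ) : outer z * outer z = (∑ j, ‖z j‖ ^ 2) • outer z := by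
  have h : star z ⬝ᵥ z = ((∑ j, ‖z j‖ ^ 2 : ℝ) : ℂ) := by
    rw [dotProduct, Complex.ofReal_sum]
    refine Finset.sum_congr rfl fun j _ => ?_
    rw [Pi.star_apply, Complex.star_def, Complex.conj_mul', ← Complex.ofReal_pow]
  rw [outer, Matrix.vecMulVec_mul_vecMulVec, h]
  ext i j
  simp [Matrix.vecMulVec_apply]
  ring

theorem reTrace_outer (z : ι → ℂ) : reTrace (outer z) = ∑ j, ‖z j‖ ^ 2 := by
  rw [reTrace_apply, outer, Matrix.trace_vecMulVec, dotProduct_comm, star_dotProduct_self_re]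

theorem reTrace_mul_outer (A : Matrix ι ι ℂ) (c : ι → ℂ) :
    reTrace (A * outer c) = (star c ⬝ᵥ A *ᵥ c).re := by
  rw [reTrace_apply, outer, Matrix.mul_vecMulVec, Matrix.trace_vecMulVec, dotProduct_comm]

theorem reTrace_outer_mul_outer (z c : ι → ℂ) :
    reTrace (outer z * outer c) = ‖star c ⬝ᵥ z‖ ^ 2 := by
  have h : star z ⬝ᵥ c = star (star c ⬝ᵥ z) := by rw [Matrix.star_dotProduct]
  rw [reTrace_mul_outer, outer, Matrix.vecMulVec_mulVec, dotProduct_smul, h]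
  simp only [MulOpposite.smul_eq_mul_unop, MulOpposite.unop_op]
  rw [Complex.star_def, Complex.mul_conj', ← Complex.ofReal_pow, Complex.ofReal_re]

end Outer

/-- A continuous function of a random element of a compact set is integrable. -/
theorem integrable_comp_of_isCompact {α E F : Type*} [MeasurableSpace α] {μ : Measure α}
    [IsFiniteMeasure μ] [TopologicalSpace E] [TopologicalSpace.PseudoMetrizableSpace E]
    [SecondCountableTopology E] [MeasurableSpace E] [OpensMeasurableSpace E]
    [NormedAddCommGroup F] {s : Set E} (hs : IsCompact s) {u : α → E} (hu : Measurable u)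
    (hus : ∀ x, u x ∈ s) {Φ : E → F} (hΦ : Continuous Φ) :
    Integrable (fun x => Φ (u x)) μ := by
  obtain ⟨C, hC⟩ := hs.exists_bound_of_continuousOn hΦ.continuousOn
  exact Integrable.of_bound (hΦ.comp_stronglyMeasurable hu.stronglyMeasurable).aestronglyMeasurable
    C (Filter.Eventually.of_forall fun x => hC _ (hus x))

section SqBall

variable {ι : Type*} [Fintype ι]

/-- The closed Euclidean ball of squared radius `B` in `ℂ^ι`. -/
def sqBall (ι : Type*) [Fintype ι] (B : ℝ) : Set (ι → ℂ) := {z | ∑ j, ‖z j‖ ^ 2 ≤ B}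

theorem isCompact_sqBall (B : ℝ) : IsCompact (sqBall ι B) := by
  refine Metric.isCompact_of_isClosed_isBounded
    (isClosed_le (by fun_prop) continuous_const) ?_
  refine (Metric.isBounded_closedBall (x := (0 : ι → ℂ)) (r := √B)).subset fun z hz => ?_
  rw [mem_closedBall_zero_iff, pi_norm_le_iff_of_nonneg (Real.sqrt_nonneg _)]
  intro j
  exact Real.le_sqrt_of_sq_le
    ((Finset.single_le_sum (f := fun j => ‖z j‖ ^ 2) (fun j _ => sq_nonneg _)
      (Finset.mem_univ j)).trans hz)

theorem reTrace_outer_sq_mul_le [DecidableEq ι] {z : ι → ℂ} {B : ℝ} (hz : z ∈ sqBall ι B)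
    {C : Matrix ι ι ℂ} (hC : C.PosSemidef) :
    reTrace (outer z * outer z * C) ≤ B * reTrace (outer z * C) := by
  rw [outer_mul_outer, smul_mul_assoc, map_smul, smul_eq_mul]
  exact mul_le_mul_of_nonneg_right hz (reTrace_mul_nonneg (posSemidef_outer _) hC)

section Mean

variable {Ω : Type*} [MeasurableSpace Ω] (ρ : Measure Ω) (v : Ω → ι → ℂ)

/-- The mean `∫ v v* dρ` of the rank-one matrices of a random vector. -/
def meanOuter : Matrix ι ι ℂ := Matrix.of fun j k => ∫ x, outer (v x) j k ∂ρ

variable {v}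

theorem isHermitian_meanOuter : (meanOuter ρ v).IsHermitian := by
  ext j k
  have h : ∀ x, star (outer (v x) k j) = outer (v x) j k := fun x =>
    (posSemidef_outer (v x)).1.apply j k
  rw [Matrix.conjTranspose_apply, meanOuter, Matrix.of_apply, Matrix.of_apply, Complex.star_def,
    ← integral_conj]
  exact integral_congr_ae (Filter.Eventually.of_forall h)

theorem reTrace_meanOuter_mul_le [DecidableEq ι] {l : ℝ}
    (hl : ∀ c : ι → ℂ, reTrace (meanOuter ρ v * outer c) ≤ l * ∑ j, ‖c j‖ ^ 2)
    {C : Matrix ι ι ℂ} (hC : C.PosSemidef) :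
    reTrace (meanOuter ρ v * C) ≤ l * reTrace C := by
  have hTh : (meanOuter ρ v).IsHermitian := isHermitian_meanOuter ρ
  have hlh : (l • (1 : Matrix ι ι ℂ)).IsHermitian := by
    rw [Matrix.IsHermitian, Matrix.conjTranspose_smul, Matrix.conjTranspose_one, star_trivial]
  have hP : (l • (1 : Matrix ι ι ℂ) - meanOuter ρ v).PosSemidef := by
    refine Matrix.PosSemidef.of_dotProduct_mulVec_nonneg (hlh.sub hTh) fun c => ?_
    rw [Complex.le_def]
    refine ⟨?_, ?_⟩
    · rw [Complex.zero_re, ← reTrace_mul_outer, sub_mul, map_sub, smul_mul_assoc, one_mul, map_smul,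
        reTrace_outer, smul_eq_mul]
      exact sub_nonneg.2 (hl c)
    · have := (hlh.sub hTh).im_star_dotProduct_mulVec_self c
      simpa using this.symm
  have h := reTrace_mul_nonneg hP hC
  rw [sub_mul, map_sub, smul_mul_assoc, one_mul, map_smul, smul_eq_mul] at h
  linarith

variable [IsProbabilityMeasure ρ] {B : ℝ} (hv : Measurable v) (hB : ∀ x, v x ∈ sqBall ι B)

include hv hB

theorem integrable_outer_apply (j k : ι) : Integrable (fun x => outer (v x) j k) ρ :=
  integrable_comp_of_isCompact (Φ := fun z => outer z j k) (isCompact_sqBall B) hv hB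
    (continuous_outer.matrix_elem j k)

theorem integrable_reTrace_outer_mul (C : Matrix ι ι ℂ) :
    Integrable (fun x => reTrace (outer (v x) * C)) ρ :=
  integrable_comp_of_isCompact (Φ := fun z => reTrace (outer z * C)) (isCompact_sqBall B) hv hB
    (continuous_reTrace.comp (continuous_outer.matrix_mul continuous_const))

theorem integral_reTrace_outer_mul (C : Matrix ι ι ℂ) :
    ∫ x, reTrace (outer (v x) * C) ∂ρ = reTrace (meanOuter ρ v * C) := by
  have hi : ∀ j k, Integrable (fun x => outer (v x) j k * C k j) ρ := fun j k =>
    (integrable_outer_apply ρ hv hB j k).mul_const _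
  have h := Complex.reCLM.integral_comp_comm (μ := ρ) (φ := fun x => ∑ j, ∑ k,
    outer (v x) j k * C k j) (integrable_finsetSum _ fun j _ =>
      integrable_finsetSum _ fun k _ => hi j k)
  rw [integral_finsetSum _ fun j _ => integrable_finsetSum _ fun k _ => hi j k] at h
  simp only [integral_finsetSum _ fun k (_ : k ∈ Finset.univ) => hi _ k, integral_mul_const] at h
  exact h

variable [DecidableEq ι]

theorem reTrace_meanOuter_le : reTrace (meanOuter ρ v) ≤ B := by
  have h := integral_reTrace_outer_mul ρ hv hB 1
  simp only [mul_one] at h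
  rw [← h]
  have h1 := integrable_reTrace_outer_mul ρ hv hB 1
  simp only [mul_one] at h1
  calc ∫ x, reTrace (outer (v x)) ∂ρ ≤ ∫ _, B ∂ρ :=
        integral_mono h1 (integrable_const _) fun x => by
          simp only [reTrace_outer]; exact hB x
    _ = B := by simp

theorem reTrace_meanOuter_nonneg : 0 ≤ reTrace (meanOuter ρ v) := by
  have h := integral_reTrace_outer_mul ρ hv hB 1
  simp only [mul_one] at h
  rw [← h]
  refine integral_nonneg fun x => ?_
  simp only [reTrace_outer, Pi.zero_apply]
  positivity

/-- Jensen's inequality `(∫ A)² ≤ ∫ A²` for `A = v v*`, combined with `A² ≤ B A`. -/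
theorem reTrace_meanOuter_sq_mul_le {C : Matrix ι ι ℂ} (hC : C.PosSemidef) :
    reTrace (meanOuter ρ v * meanOuter ρ v * C) ≤ B * reTrace (meanOuter ρ v * C) := by
  set T := meanOuter ρ v with hT
  have hTh : T.IsHermitian := isHermitian_meanOuter ρ
  have hpt : ∀ x, reTrace (outer (v x) * (T * C)) + reTrace (outer (v x) * (C * T)) ≤
      B * reTrace (outer (v x) * C) + reTrace (T * T * C) := fun x => by
    have h1 := reTrace_sq_mul_nonneg ((posSemidef_outer (v x)).1.sub hTh) hC
    have h2 := reTrace_outer_sq_mul_le (hB x) hC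
    have h3 : reTrace (T * outer (v x) * C) = reTrace (outer (v x) * (C * T)) := by
      rw [mul_assoc, reTrace_mul_comm, mul_assoc]
    simp only [sub_mul, mul_sub, map_sub] at h1
    rw [h3, mul_assoc (outer (v x)) T C] at h1
    linarith
  have hi := integrable_reTrace_outer_mul ρ hv hB
  have h := integral_mono ((hi (T * C)).add (hi (C * T)))
    (((hi C).const_mul B).add (integrable_const (reTrace (T * T * C)))) hpt
  simp only [Pi.add_apply] at h
  rw [integral_add (hi _) (hi _), integral_add ((hi C).const_mul B) (integrable_const _),
    integral_const_mul, integral_reTrace_outer_mul ρ hv hB, integral_reTrace_outer_mul ρ hv hB,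
    integral_reTrace_outer_mul ρ hv hB, ← hT] at h
  have h4 : reTrace (T * (C * T)) = reTrace (T * T * C) := by
    rw [reTrace_mul_comm, mul_assoc, reTrace_mul_comm]
  rw [h4, ← mul_assoc] at h
  simp only [integral_const, probReal_univ, one_smul] at h
  linarith

end Mean

end SqBall

/-! ### Adding a summand to a centered sum -/

section CenteredSum

variable {ι : Type*}

/-- The sum `∑ᵢ (wᵢ wᵢ* - T)`. -/
def centeredSum (T : Matrix ι ι ℂ) {n : ℕ} (w : Fin n → ι → ℂ) : Matrix ι ι ℂ :=
  ∑ i, (outer (w i) - T)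

theorem continuous_centeredSum (T : Matrix ι ι ℂ) (n : ℕ) :
    Continuous (centeredSum T : (Fin n → ι → ℂ) → Matrix ι ι ℂ) :=
  continuous_finsetSum _ fun i _ =>
    (continuous_outer.comp (continuous_apply i)).sub continuous_const

theorem centeredSum_succAbove (T : Matrix ι ι ℂ) {m : ℕ} (w : Fin (m + 1) → ι → ℂ)
    (i : Fin (m + 1)) :
    centeredSum T w = (outer (w i) - T) + centeredSum T fun j => w (i.succAbove j) :=
  Fin.sum_univ_succAbove _ i

variable [Fintype ι]

theorem isHermitian_centeredSum {T : Matrix ι ι ℂ} (hT : T.IsHermitian) {n : ℕ}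
    (w : Fin n → ι → ℂ) : (centeredSum T w).IsHermitian := by
  rw [Matrix.IsHermitian, centeredSum, Matrix.conjTranspose_sum]
  exact Finset.sum_congr rfl fun i _ => ((posSemidef_outer (w i)).1.sub hT).eq

variable [DecidableEq ι]

/-- The effect of adding one centered summand `z z* - T` to a Hermitian matrix `R`. The last trace
is linear in `z z* - T`, so that it averages to zero when `z` is independent of `R`. -/
theorem reTrace_centered_mul_matSinh_le {T R : Matrix ι ι ℂ} (hT : T.IsHermitian)
    (hR : R.IsHermitian) {B l θ : ℝ} (hB : 0 ≤ B) (hl : 0 ≤ l) (hθ : 0 < θ)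
    (hTB : ∀ C : Matrix ι ι ℂ, C.PosSemidef → reTrace (T * T * C) ≤ B * reTrace (T * C))
    (hTl : ∀ C : Matrix ι ι ℂ, C.PosSemidef → reTrace (T * C) ≤ l * reTrace C)
    {z : ι → ℂ} (hz : z ∈ sqBall ι B) :
    reTrace ((outer z - T) * matSinh (θ • ((outer z - T) + R))) ≤
      θ * B * (reTrace ((outer z - T) * matCosh (θ • ((outer z - T) + R))) +
        4 * (l * reTrace (matCosh (θ • ((outer z - T) + R)) - 1) + reTrace T)) +
      reTrace ((outer z - T) *
        ((1 - 2 * θ ^ 2 * B * l) • matSinh (θ • R) + (θ * B) • matCosh (θ • R))) := by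
  set Z := outer z - T with hZ
  set S := Z + R with hS
  have hZh : Z.IsHermitian := (posSemidef_outer z).1.sub hT
  have hsm : ∀ A : Matrix ι ι ℂ, A.IsHermitian → (θ • A).IsHermitian := fun A hA => by
    rw [Matrix.IsHermitian, Matrix.conjTranspose_smul, star_trivial, hA.eq]
  have hSh := hsm S (hZh.add hR)
  have hRh := hsm R hR
  have hdiff : θ • S - θ • R = θ • Z := by rw [← smul_sub, hS, add_sub_cancel_right]
  set C₁ := matCosh (θ • S) with hC₁
  set C₂ := matCosh (θ • R) with hC₂
  have p₁ : C₁.PosSemidef := posSemidef_matCosh hSh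
  have p₂ : C₂.PosSemidef := posSemidef_matCosh hRh
  have key : ∀ C : Matrix ι ι ℂ, C.PosSemidef →
      reTrace (Z * Z * C) ≤ 2 * B * (reTrace (Z * C) + 2 * reTrace (T * C)) := fun C hC => by
    have h1 := reTrace_sub_sq_mul_le (posSemidef_outer z).1 hT hC
    have h2 := reTrace_outer_sq_mul_le hz hC
    have h3 := hTB C hC
    have h4 : reTrace (Z * C) = reTrace (outer z * C) - reTrace (T * C) := by
      rw [hZ, sub_mul, map_sub]
    rw [h4]
    linarith
  have mvt : reTrace (Z * matSinh (θ • S)) ≤ reTrace (Z * matSinh (θ • R)) +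
      θ / 2 * (reTrace (Z * Z * C₁) + reTrace (Z * Z * C₂)) := by
    have h := reTrace_sub_mul_matSinh_sub_le hSh hRh
    rw [hdiff] at h
    simp only [smul_mul_assoc, mul_smul_comm, map_smul, smul_eq_mul, mul_sub, mul_add, map_sub,
      map_add, ← hC₁, ← hC₂] at h
    refine le_of_mul_le_mul_left ?_ hθ
    linarith
  have klein : reTrace (C₂ - 1) + θ * reTrace (Z * matSinh (θ • R)) ≤ reTrace (C₁ - 1) := by
    have h := reTrace_matCosh_add_le hSh hRh
    rw [hdiff, smul_mul_assoc, map_smul, smul_eq_mul] at h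
    rw [map_sub, map_sub]
    linarith
  have t₁ : reTrace (T * C₁) ≤ l * reTrace (C₁ - 1) + reTrace T := by
    have h := hTl _ (posSemidef_matCosh_sub_one hSh)
    rw [mul_sub, mul_one, map_sub reTrace (T * _)] at h
    linarith
  have t₂ : reTrace (T * C₂) ≤ l * reTrace (C₂ - 1) + reTrace T := by
    have h := hTl _ (posSemidef_matCosh_sub_one hRh)
    rw [mul_sub, mul_one, map_sub reTrace (T * _)] at h
    linarith
  have t₃ : reTrace (T * C₂) ≤
      l * (reTrace (C₁ - 1) - θ * reTrace (Z * matSinh (θ • R))) + reTrace T :=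
    t₂.trans (add_le_add_left (mul_le_mul_of_nonneg_left (by linarith) hl) _)
  have hθB : 0 ≤ θ * B := mul_nonneg hθ.le hB
  rw [mul_add Z, map_add reTrace (Z * _), mul_smul_comm, mul_smul_comm, map_smul, map_smul,
    smul_eq_mul, smul_eq_mul]
  have e₁ := mul_le_mul_of_nonneg_left (add_le_add (key C₁ p₁) (key C₂ p₂))
    (show 0 ≤ θ / 2 by positivity)
  have e₂ := mul_le_mul_of_nonneg_left (add_le_add t₁ t₃) (show 0 ≤ 2 * (θ * B) by positivity)
  linarith

/-- The matrix that multiplies a summand in the mean-zero part of the bound for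
`D sinh (θ D)`, where `D` is a centered sum; it depends on the other summands only. -/
def remainderFactor (T : Matrix ι ι ℂ) (B l θ : ℝ) {m : ℕ} (w : Fin m → ι → ℂ) : Matrix ι ι ℂ :=
  (1 - 2 * θ ^ 2 * B * l) • matSinh (θ • centeredSum T w) +
    (θ * B) • matCosh (θ • centeredSum T w) + (θ * B) • 1

theorem continuous_remainderFactor (T : Matrix ι ι ℂ) (B l θ : ℝ) (m : ℕ) :
    Continuous (remainderFactor T B l θ : (Fin m → ι → ℂ) → Matrix ι ι ℂ) := by
  have h := (continuous_centeredSum T m).const_smul θ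
  exact (((continuous_matSinh.comp h).const_smul (1 - 2 * θ ^ 2 * B * l)).add
    ((continuous_matCosh.comp h).const_smul (θ * B))).add continuous_const

theorem reTrace_centeredSum_mul_matSinh_le {T : Matrix ι ι ℂ} (hT : T.IsHermitian)
    {B l θ : ℝ} (hB : 0 ≤ B) (hl : 0 ≤ l) (hθ : 0 < θ)
    (hTB : ∀ C : Matrix ι ι ℂ, C.PosSemidef → reTrace (T * T * C) ≤ B * reTrace (T * C))
    (hTl : ∀ C : Matrix ι ι ℂ, C.PosSemidef → reTrace (T * C) ≤ l * reTrace C)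
    {m : ℕ} {w : Fin (m + 1) → ι → ℂ} (hw : ∀ i, w i ∈ sqBall ι B) :
    reTrace (centeredSum T w * matSinh (θ • centeredSum T w)) ≤
      θ * B * reTrace (centeredSum T w * matSinh (θ • centeredSum T w)) +
      4 * (m + 1 : ℕ) * (θ * B) *
        (l * reTrace (matCosh (θ • centeredSum T w) - 1) + reTrace T) +
      ∑ i, reTrace ((outer (w i) - T) *
        remainderFactor T B l θ fun j => w (i.succAbove j)) := by
  set D := centeredSum T w with hD
  have hDh : D.IsHermitian := isHermitian_centeredSum hT w
  have hi : ∀ i, reTrace ((outer (w i) - T) * matSinh (θ • D)) ≤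
      θ * B * (reTrace ((outer (w i) - T) * (matCosh (θ • D) - 1)) +
        4 * (l * reTrace (matCosh (θ • D) - 1) + reTrace T)) +
      reTrace ((outer (w i) - T) * remainderFactor T B l θ fun j => w (i.succAbove j)) := by
    intro i
    have h := reTrace_centered_mul_matSinh_le hT
      (isHermitian_centeredSum hT fun j => w (i.succAbove j)) hB hl hθ hTB hTl (hw i)
    rw [← centeredSum_succAbove, ← hD] at h
    rw [remainderFactor, mul_add _ _ ((θ * B) • (1 : Matrix ι ι ℂ)), map_add, mul_smul_comm,
      mul_one, map_smul, smul_eq_mul, mul_sub _ (matCosh (θ • D)), mul_one,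
      map_sub reTrace (_ * _)]
    linarith
  have hsum := Finset.sum_le_sum fun i (_ : i ∈ Finset.univ) => hi i
  have hlin : ∀ M : Matrix ι ι ℂ, ∑ i, reTrace ((outer (w i) - T) * M) = reTrace (D * M) :=
    fun M => by rw [← map_sum, ← Finset.sum_mul]; rfl
  rw [Finset.sum_add_distrib, ← Finset.mul_sum, Finset.sum_add_distrib, hlin, hlin,
    Finset.sum_const, Finset.card_univ, Fintype.card_fin, nsmul_eq_mul] at hsum
  have h2 := mul_le_mul_of_nonneg_left (reTrace_mul_matCosh_sub_one_le hDh hθ.le)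
    (mul_nonneg hθ.le hB)
  linarith

section Random

variable {Ω : Type*} [MeasurableSpace Ω] (ρ : Measure Ω) [IsProbabilityMeasure ρ] {v : Ω → ι → ℂ}
  {B : ℝ} (hv : Measurable v) (hB : ∀ x, v x ∈ sqBall ι B)

include hv hB

omit [DecidableEq ι] in
theorem integrable_comp_sample {F : Type*} [NormedAddCommGroup F] {n : ℕ}
    {Φ : (Fin n → ι → ℂ) → F} (hΦ : Continuous Φ) :
    Integrable (fun X : Fin n → Ω => Φ fun i => v (X i)) (Measure.pi fun _ => ρ) :=
  integrable_comp_of_isCompact (isCompact_univ_pi fun _ => isCompact_sqBall B)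
    (u := fun (X : Fin n → Ω) i => v (X i)) (by fun_prop) (fun X i _ => hB _) hΦ

omit [DecidableEq ι] in
/-- A centered summand is uncorrelated with every function of the other summands. -/
theorem integral_reTrace_centered_mul_eq_zero {m : ℕ} (i : Fin (m + 1))
    {M : (Fin m → ι → ℂ) → Matrix ι ι ℂ} (hM : Continuous M) :
    ∫ X, reTrace ((outer (v (X i)) - meanOuter ρ v) * M fun j => v (X (i.succAbove j)))
      ∂(Measure.pi fun _ : Fin (m + 1) => ρ) = 0 := by
  set Φ : (ι → ℂ) × (Fin m → ι → ℂ) → ℝ := fun p =>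
    reTrace ((outer p.1 - meanOuter ρ v) * M p.2) with hΦ
  have hΦc : Continuous Φ := continuous_reTrace.comp
    (((continuous_outer.comp continuous_fst).sub continuous_const).matrix_mul
      (hM.comp continuous_snd))
  have hint : Integrable (fun p : Ω × (Fin m → Ω) => Φ (v p.1, fun j => v (p.2 j)))
      (ρ.prod (Measure.pi fun _ : Fin m => ρ)) :=
    integrable_comp_of_isCompact
      ((isCompact_sqBall B).prod (isCompact_univ_pi fun _ : Fin m => isCompact_sqBall B))
      (u := fun p : Ω × (Fin m → Ω) => (v p.1, fun j => v (p.2 j))) (by fun_prop)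
      (fun p => ⟨hB _, fun j _ => hB _⟩) hΦc
  have hmp := (measurePreserving_piFinSuccAbove (fun _ : Fin (m + 1) => ρ) i).integral_comp'
    (fun p : Ω × (Fin m → Ω) => Φ (v p.1, fun j => v (p.2 j)))
  refine Eq.trans ?_ (hmp.trans ?_)
  · rfl
  · rw [integral_prod_symm _ hint]
    refine (integral_congr_ae (Filter.Eventually.of_forall fun Y => ?_)).trans (integral_zero _ _)
    set C := M fun j => v (Y j) with hC
    have h1 : ∀ x, Φ (v x, fun j => v (Y j)) =
        reTrace (outer (v x) * C) - reTrace (meanOuter ρ v * C) := fun x => by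
      simp only [hΦ, sub_mul, map_sub, ← hC]
    simp only [h1]
    rw [integral_sub (integrable_reTrace_outer_mul ρ hv hB C) (integrable_const _),
      integral_reTrace_outer_mul ρ hv hB]
    simp

end Random

end CenteredSum

/-! ### The Laplace transform and the tail bound -/

/-- With `u` the exponent of the Laplace transform, this is the numerical estimate that turns the
ratio left by Markov's inequality into the claimed bound when `u ≥ 1`. -/
theorem exp_sub_one_le_of_one_le {u : ℝ} (hu : 1 ≤ u) :
    Real.exp u - 1 ≤ (Real.cosh (2 * u) - 1) *
      ((2 : ℝ) ^ (3 / 4 : ℝ) * (10 * u) * Real.exp (-(10 / 21 * u))) := by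
  have h1 : (2 : ℝ) ≤ Real.exp u := by linarith [Real.add_one_le_exp u]
  have hpos := Real.exp_pos u
  have h2 : Real.exp u ^ 2 / 2 - 1 ≤ Real.cosh (2 * u) - 1 := by
    rw [Real.cosh_eq, ← Real.exp_nat_mul]
    have := Real.exp_pos (-(2 * u))
    push_cast
    linarith
  have h3 : (1 : ℝ) ≤ 2 ^ (3 / 4 : ℝ) := Real.one_le_rpow (by norm_num) (by norm_num)
  have h4 : (Real.exp u)⁻¹ ≤ Real.exp (-(10 / 21 * u)) := by
    rw [← Real.exp_neg]; exact Real.exp_le_exp.2 (by linarith)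
  have h5 : 1 * (10 * 1) * (Real.exp u)⁻¹ ≤
      (2 : ℝ) ^ (3 / 4 : ℝ) * (10 * u) * Real.exp (-(10 / 21 * u)) := by gcongr
  have h6 : 0 ≤ Real.exp u ^ 2 / 2 - 1 := by nlinarith
  refine le_trans ?_ (mul_le_mul h2 h5 (by positivity) (h6.trans h2))
  rw [← div_eq_mul_inv, mul_div_assoc', le_div_iff₀ hpos]
  nlinarith

/-- For `u ≤ 1` the claimed bound is trivial; this uses `log 2 ≥ 40 / 63`. -/
theorem one_le_rpow_mul_exp {u : ℝ} (hu : u ≤ 1) :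
    1 ≤ (2 : ℝ) ^ (3 / 4 : ℝ) * Real.exp (-(10 / 21 * u)) := by
  rw [Real.rpow_def_of_pos (by norm_num), ← Real.exp_add]
  exact Real.one_le_exp (by linarith [Real.log_two_gt_d9])

section Tail

variable {ι : Type*} [Fintype ι] [DecidableEq ι]

variable {Ω : Type*} [MeasurableSpace Ω] (ρ : Measure Ω) (v : Ω → ι → ℂ)

/-- The expected trace of `cosh (θ D) - 1`, where `D` is the centered sum of `n` independent copies
of `v v*`. Subtracting `1` keeps the quantity bounded independently of the dimension. -/
def coshTrace (n : ℕ) (θ : ℝ) : ℝ :=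
  ∫ X : Fin n → Ω, reTrace (matCosh (θ • centeredSum (meanOuter ρ v) fun i => v (X i)) - 1)
    ∂(Measure.pi fun _ => ρ)

/-- The expected trace of `D sinh (θ D)`, the derivative of `coshTrace` in `θ`. -/
def sinhTrace (n : ℕ) (θ : ℝ) : ℝ :=
  ∫ X : Fin n → Ω, reTrace ((centeredSum (meanOuter ρ v) fun i => v (X i)) *
    matSinh (θ • centeredSum (meanOuter ρ v) fun i => v (X i))) ∂(Measure.pi fun _ => ρ)

theorem reTrace_matCosh_smul_sub_one_nonneg (n : ℕ) (θ : ℝ) (X : Fin n → Ω) :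
    0 ≤ reTrace (matCosh (θ • centeredSum (meanOuter ρ v) fun i => v (X i)) - 1) := by
  have hD : (θ • centeredSum (meanOuter ρ v) fun i => v (X i)).IsHermitian := by
    rw [Matrix.IsHermitian, Matrix.conjTranspose_smul, star_trivial,
      (isHermitian_centeredSum (isHermitian_meanOuter ρ) _).eq]
  exact (Complex.le_def.1 (posSemidef_matCosh_sub_one hD).trace_nonneg).1

theorem coshTrace_nonneg (n : ℕ) (θ : ℝ) : 0 ≤ coshTrace ρ v n θ :=
  integral_nonneg (reTrace_matCosh_smul_sub_one_nonneg ρ v n θ)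

theorem coshTrace_zero (n : ℕ) : coshTrace ρ v n 0 = 0 := by
  have h : matCosh (0 : Matrix ι ι ℂ) = 1 := by
    have := matCosh_conjDiag (1 : Matrix.unitaryGroup ι ℂ) 0
    simpa [conjDiag] using this
  simp [coshTrace, h]

variable [IsProbabilityMeasure ρ] {v} {B : ℝ} (hv : Measurable v) (hB : ∀ x, v x ∈ sqBall ι B)

include hv hB

theorem integrable_reTrace_matCosh_sub_one (n : ℕ) (θ : ℝ) :
    Integrable (fun X : Fin n → Ω =>
      reTrace (matCosh (θ • centeredSum (meanOuter ρ v) fun i => v (X i)) - 1))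
      (Measure.pi fun _ => ρ) :=
  integrable_comp_sample ρ hv hB
    (Φ := fun w => reTrace (matCosh (θ • centeredSum (meanOuter ρ v) w) - 1))
    (continuous_reTrace.comp ((continuous_matCosh.comp
      ((continuous_centeredSum _ n).const_smul θ)).sub continuous_const))

theorem integrable_reTrace_mul_matSinh (n : ℕ) (θ : ℝ) :
    Integrable (fun X : Fin n → Ω => reTrace ((centeredSum (meanOuter ρ v) fun i => v (X i)) *
      matSinh (θ • centeredSum (meanOuter ρ v) fun i => v (X i)))) (Measure.pi fun _ => ρ) :=
  integrable_comp_sample ρ hv hB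
    (Φ := fun w => reTrace (centeredSum (meanOuter ρ v) w *
      matSinh (θ • centeredSum (meanOuter ρ v) w)))
    (continuous_reTrace.comp ((continuous_centeredSum _ n).matrix_mul (continuous_matSinh.comp
      ((continuous_centeredSum _ n).const_smul θ))))

theorem hasDerivAt_coshTrace (n : ℕ) (θ : ℝ) :
    HasDerivAt (coshTrace ρ v n) (sinhTrace ρ v n θ) θ := by
  set T := meanOuter ρ v with hT
  have hcont : Continuous fun p : ℝ × (Fin n → ι → ℂ) =>
      reTrace (centeredSum T p.2 * matSinh (p.1 • centeredSum T p.2)) := by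
    have h := (continuous_centeredSum T n).comp (continuous_snd (X := ℝ))
    exact continuous_reTrace.comp (h.matrix_mul
      (continuous_matSinh.comp (continuous_fst.smul h)))
  obtain ⟨C, hC⟩ := ((isCompact_Icc (a := θ - 1) (b := θ + 1)).prod
    (isCompact_univ_pi fun _ : Fin n => isCompact_sqBall (ι := ι) B)).exists_bound_of_continuousOn
      hcont.continuousOn
  refine (hasDerivAt_integral_of_dominated_loc_of_deriv_le
    (s := Set.Icc (θ - 1) (θ + 1)) (bound := fun _ => C)
    (Icc_mem_nhds (by linarith) (by linarith))
    (Filter.Eventually.of_forall fun s =>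
      (integrable_reTrace_matCosh_sub_one ρ hv hB n s).aestronglyMeasurable)
    (integrable_reTrace_matCosh_sub_one ρ hv hB n θ)
    (integrable_reTrace_mul_matSinh ρ hv hB n θ).aestronglyMeasurable
    (Filter.Eventually.of_forall fun X s hs => hC (s, fun i => v (X i)) ⟨hs, fun i _ => hB _⟩)
    (integrable_const _)
    (Filter.Eventually.of_forall fun X s _ => ?_)).2
  simp only [map_sub]
  exact (hasDerivAt_reTrace_matCosh _ s).sub_const _

/-- The differential inequality for the matrix Laplace transform. -/
theorem sinhTrace_le {l θ : ℝ} (hl0 : 0 ≤ l) (hB0 : 0 ≤ B)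
    (hl : ∀ c : ι → ℂ, reTrace (meanOuter ρ v * outer c) ≤ l * ∑ j, ‖c j‖ ^ 2)
    (hθ : 0 < θ) (m : ℕ) :
    sinhTrace ρ v (m + 1) θ ≤ θ * B * sinhTrace ρ v (m + 1) θ +
      4 * (m + 1 : ℕ) * (θ * B) *
        (l * coshTrace ρ v (m + 1) θ + reTrace (meanOuter ρ v)) := by
  set T := meanOuter ρ v with hT
  have hs := integrable_reTrace_mul_matSinh ρ hv hB (m + 1) θ
  have hc := integrable_reTrace_matCosh_sub_one ρ hv hB (m + 1) θ
  have hr : ∀ i : Fin (m + 1), Integrable (fun X : Fin (m + 1) → Ω =>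
      reTrace ((outer (v (X i)) - T) *
        remainderFactor T B l θ fun j => v (X (i.succAbove j)))) (Measure.pi fun _ => ρ) :=
    fun i => integrable_comp_sample ρ hv hB
      (Φ := fun w => reTrace ((outer (w i) - T) *
        remainderFactor T B l θ fun j => w (i.succAbove j)))
      (continuous_reTrace.comp (((continuous_outer.comp (continuous_apply i)).sub
        continuous_const).matrix_mul ((continuous_remainderFactor T B l θ m).comp
          (continuous_pi fun j => continuous_apply (i.succAbove j)))))
  have hpt : ∀ X : Fin (m + 1) → Ω, _ := fun X =>
    reTrace_centeredSum_mul_matSinh_le (isHermitian_meanOuter ρ) hB0 hl0 hθ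
      (fun C hC => reTrace_meanOuter_sq_mul_le ρ hv hB hC)
      (fun C hC => reTrace_meanOuter_mul_le ρ hl hC) (w := fun i => v (X i)) (fun i => hB _)
  set D : (Fin (m + 1) → Ω) → Matrix ι ι ℂ := fun X => centeredSum T fun i => v (X i) with hD
  set f : (Fin (m + 1) → Ω) → ℝ := fun X => reTrace (D X * matSinh (θ • D X)) with hf
  set g : (Fin (m + 1) → Ω) → ℝ := fun X => reTrace (matCosh (θ • D X) - 1) with hg
  set R : (Fin (m + 1) → Ω) → ℝ := fun X => ∑ i, reTrace ((outer (v (X i)) - T) *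
    remainderFactor T B l θ fun j => v (X (i.succAbove j))) with hR
  have h1 := hs.const_mul (θ * B)
  have hlc : Integrable (fun X => l * g X + reTrace T) (Measure.pi fun _ => ρ) :=
    (hc.const_mul l).add (integrable_const _)
  have h2 := hlc.const_mul (4 * (m + 1 : ℕ) * (θ * B))
  have h3 : Integrable R (Measure.pi fun _ => ρ) := integrable_finsetSum _ fun i _ => hr i
  have h12 : Integrable (fun X => θ * B * f X +
      4 * (m + 1 : ℕ) * (θ * B) * (l * g X + reTrace T)) (Measure.pi fun _ => ρ) := h1.add h2
  have hR0 : ∫ X, R X ∂(Measure.pi fun _ => ρ) = 0 := by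
    rw [hR, integral_finsetSum _ fun i _ => hr i]
    exact Finset.sum_eq_zero fun i _ => integral_reTrace_centered_mul_eq_zero ρ hv hB i
      (continuous_remainderFactor T B l θ m)
  have h : ∫ X, f X ∂(Measure.pi fun _ => ρ) ≤ ∫ X, (θ * B * f X +
      4 * (m + 1 : ℕ) * (θ * B) * (l * g X + reTrace T)) + R X ∂(Measure.pi fun _ => ρ) :=
    integral_mono hs (h12.add h3) hpt
  rw [integral_add h12 h3, integral_add h1 h2, integral_const_mul, integral_const_mul,
    integral_add (hc.const_mul l) (integrable_const _), integral_const_mul, hR0, add_zero,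
    integral_const, probReal_univ, one_smul] at h
  exact h

/-- Integrating the differential inequality. -/
theorem mul_coshTrace_add_le {l θ : ℝ} (hl0 : 0 ≤ l) (hB0 : 0 ≤ B)
    (hl : ∀ c : ι → ℂ, reTrace (meanOuter ρ v * outer c) ≤ l * ∑ j, ‖c j‖ ^ 2)
    (hθ : 0 ≤ θ) (hθB : 5 * (θ * B) ≤ 1) {n : ℕ} (hn : 1 ≤ n) :
    l * coshTrace ρ v n θ + reTrace (meanOuter ρ v) ≤
      reTrace (meanOuter ρ v) * Real.exp (5 / 2 * n * B * l * θ ^ 2) := by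
  obtain ⟨m, rfl⟩ : ∃ m, n = m + 1 := ⟨n - 1, by omega⟩
  set T := meanOuter ρ v with hT
  set k : ℝ := 5 / 2 * (m + 1 : ℕ) * B * l with hk
  set G : ℝ → ℝ := fun s => l * coshTrace ρ v (m + 1) s + reTrace T with hG
  have hd : ∀ s, HasDerivAt (fun s => G s * Real.exp (-(k * s ^ 2)))
      ((l * sinhTrace ρ v (m + 1) s - 2 * k * s * G s) * Real.exp (-(k * s ^ 2))) s := fun s => by
    have h1 := ((hasDerivAt_coshTrace ρ hv hB (m + 1) s).const_mul l).add_const (reTrace T)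
    have h2 := ((((hasDerivAt_id s).pow 2).const_mul k).neg).exp
    refine (h1.mul h2).congr_deriv ?_
    simp only [hG, id, Pi.neg_apply, Pi.pow_apply]
    push_cast
    ring
  -- `G` times the reciprocal of the claimed growth factor is nonincreasing.
  have hanti : AntitoneOn (fun s => G s * Real.exp (-(k * s ^ 2))) (Set.Icc 0 θ) := by
    refine antitoneOn_of_deriv_nonpos (convex_Icc 0 θ)
      (fun s _ => (hd s).continuousAt.continuousWithinAt)
      (fun s _ => (hd s).differentiableAt.differentiableWithinAt) fun s hs => ?_
    rw [interior_Icc] at hs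
    rw [(hd s).deriv]
    refine mul_nonpos_of_nonpos_of_nonneg ?_ (Real.exp_pos _).le
    have h1 := sinhTrace_le ρ hv hB hl0 hB0 hl hs.1 m
    change _ ≤ _ + _ * G s at h1
    have hGs : 0 ≤ G s := add_nonneg (mul_nonneg hl0 (coshTrace_nonneg ρ v _ _))
      (reTrace_meanOuter_nonneg ρ hv hB)
    have hsB : 5 * (s * B) ≤ 1 := le_trans (by gcongr; exact hs.2.le) hθB
    have hsB0 : 0 ≤ s * B := mul_nonneg hs.1.le hB0
    have h2 : sinhTrace ρ v (m + 1) s ≤ 5 * (m + 1 : ℕ) * (s * B) * G s := by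
      have h3 : 0 ≤ 4 * ((m + 1 : ℕ) : ℝ) * (s * B) * G s := by positivity
      by_contra! hcon
      nlinarith
    have h4 := mul_le_mul_of_nonneg_left h2 hl0
    rw [hk]
    linarith
  have h := hanti (Set.left_mem_Icc.2 hθ) (Set.right_mem_Icc.2 hθ) hθ
  simp only [hG, coshTrace_zero, mul_zero, zero_add, ne_eq, OfNat.ofNat_ne_zero, not_false_eq_true,
    zero_pow, neg_zero, Real.exp_zero, mul_one, Real.exp_neg] at h
  rwa [← div_eq_mul_inv, div_le_iff₀ (Real.exp_pos _)] at h

/-- Tail bound for the quadratic form of a centered sum of independent rank-one matrices. -/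
theorem measureReal_exists_lt_le {l t : ℝ} (hl0 : 0 < l) (hB0 : 0 < B)
    (hl : ∀ c : ι → ℂ, reTrace (meanOuter ρ v * outer c) ≤ l * ∑ j, ‖c j‖ ^ 2)
    (ht : 0 < t) (ht1 : t ≤ 1) {n : ℕ} (hn : 1 ≤ n) :
    (Measure.pi fun _ : Fin n => ρ).real {X | ∃ c : ι → ℂ, n * t * l * ∑ j, ‖c j‖ ^ 2 <
        |reTrace ((centeredSum (meanOuter ρ v) fun i => v (X i)) * outer c)|} ≤
      (2 : ℝ) ^ (3 / 4 : ℝ) * n * Real.exp (-(n * t ^ 2 * l / (21 * B))) := by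
  have hn0 : (0 : ℝ) < n := by exact_mod_cast hn
  have hn1 : (1 : ℝ) ≤ n := by exact_mod_cast hn
  set u : ℝ := n * t ^ 2 * l / (10 * B) with hu
  have hexp : n * t ^ 2 * l / (21 * B) = 10 / 21 * u := by rw [hu]; field_simp
  rw [hexp]
  -- For `u ≤ 1` the right-hand side is at least `1`.
  rcases le_total u 1 with hu1 | hu1
  · refine measureReal_le_one.trans ((one_le_rpow_mul_exp hu1).trans ?_)
    rw [mul_right_comm]
    exact le_mul_of_one_le_right (by positivity) hn1
  -- The choice of `θ` gives `θ n t l = 2 u` and turns the exponent of the transform into `u`.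
  set θ : ℝ := t / (5 * B) with hθ
  have hθ0 : 0 ≤ θ := by positivity
  set E : Set (Fin n → Ω) := {X | ∃ c : ι → ℂ, n * t * l * ∑ j, ‖c j‖ ^ 2 <
    |reTrace ((centeredSum (meanOuter ρ v) fun i => v (X i)) * outer c)|} with hE
  have hsub : E ⊆ {X | Real.cosh (2 * u) - 1 ≤
      reTrace (matCosh (θ • centeredSum (meanOuter ρ v) fun i => v (X i)) - 1)} := by
    rintro X ⟨c, hc⟩
    rw [reTrace_mul_outer, ← star_dotProduct_self_re] at hc
    have h := cosh_sub_one_le_reTrace (isHermitian_centeredSum (isHermitian_meanOuter ρ) _) θ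
      (s := n * t * l) (by positivity) c hc
    have h2 : θ * (n * t * l) = 2 * u := by rw [hθ, hu]; field_simp; norm_num
    rwa [h2] at h
  have hF : l * coshTrace ρ v n θ ≤ B * (Real.exp u - 1) := by
    have h := mul_coshTrace_add_le ρ hv hB hl0.le hB0.le hl hθ0
      (by rw [hθ]; field_simp; exact ht1) hn
    have h2 : 5 / 2 * n * B * l * θ ^ 2 = u := by rw [hθ, hu]; field_simp; norm_num
    rw [h2] at h
    have h3 := mul_le_mul_of_nonneg_right (reTrace_meanOuter_le ρ hv hB)
      (sub_nonneg.2 (Real.one_le_exp (zero_le_one.trans hu1)))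
    linarith
  have hcosh : 0 < Real.cosh (2 * u) - 1 :=
    sub_pos.2 (Real.one_lt_cosh.2 (by positivity))
  have hM := mul_meas_ge_le_integral_of_nonneg
    (μ := Measure.pi fun _ : Fin n => ρ)
    (f := fun X => reTrace (matCosh (θ • centeredSum (meanOuter ρ v) fun i => v (X i)) - 1))
    (Filter.Eventually.of_forall (reTrace_matCosh_smul_sub_one_nonneg ρ v n θ))
    (integrable_reTrace_matCosh_sub_one ρ hv hB n θ) (Real.cosh (2 * u) - 1)
  have hP : (Real.cosh (2 * u) - 1) * (Measure.pi fun _ : Fin n => ρ).real E ≤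
      coshTrace ρ v n θ :=
    (mul_le_mul_of_nonneg_left (measureReal_mono hsub) hcosh.le).trans hM
  -- The effective dimension `B / l` is absorbed into `n`, since `n = 10 u B / (l t²)`.
  have hdim : B * (10 * u) ≤ l * n := by
    have : B * (10 * u) = l * n * t ^ 2 := by rw [hu]; field_simp
    rw [this]
    exact mul_le_of_le_one_right (by positivity) (pow_le_one₀ ht.le ht1)
  have hfin := exp_sub_one_le_of_one_le hu1
  refine le_of_mul_le_mul_left ?_ (mul_pos hl0 hcosh)
  set a : ℝ := (2 : ℝ) ^ (3 / 4 : ℝ) with ha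
  set e : ℝ := Real.exp (-(10 / 21 * u)) with he
  have ha0 : 0 < a := by positivity
  have he0 : 0 < e := Real.exp_pos _
  calc l * (Real.cosh (2 * u) - 1) * (Measure.pi fun _ : Fin n => ρ).real E
      ≤ l * coshTrace ρ v n θ := by
        rw [mul_assoc]; exact mul_le_mul_of_nonneg_left hP hl0.le
    _ ≤ B * (Real.exp u - 1) := hF
    _ ≤ B * ((Real.cosh (2 * u) - 1) * (a * (10 * u) * e)) :=
        mul_le_mul_of_nonneg_left hfin hB0.le
    _ = (Real.cosh (2 * u) - 1) * (a * e) * (B * (10 * u)) := by ring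
    _ ≤ (Real.cosh (2 * u) - 1) * (a * e) * (l * n) :=
        mul_le_mul_of_nonneg_left hdim (by positivity)
    _ = l * (Real.cosh (2 * u) - 1) * (a * n * e) := by ring

end Tail

/-! ### Transfer to the reproducing kernel Hilbert space -/

section Transfer

variable {D : Type*} {H : Type*} [NormedAddCommGroup H] [InnerProductSpace ℂ H]
  [RKHS ℂ H D ℂ]

theorem sum_coe_apply {ι : Type*} [Fintype ι] (e : ι → H) (c : ι → ℂ) (x : D) :
    (∑ j, c j • e j : H) x = ∑ j, c j * e j x := by
  rw [← RKHS.coeCLM_apply, map_sum, Finset.sum_apply]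
  simp

omit [RKHS ℂ H D ℂ] in
theorem norm_sum_smul_sq {ι : Type*} [Fintype ι] {e : ι → H} (he : Orthonormal ℂ e) (c : ι → ℂ) :
    ‖(∑ j, c j • e j : H)‖ ^ 2 = ∑ j, ‖c j‖ ^ 2 := by
  have h := inner_self_eq_norm_sq_to_K (𝕜 := ℂ) (∑ j, c j • e j : H)
  rw [he.inner_sum c c Finset.univ] at h
  have h2 : ((‖(∑ j, c j • e j : H)‖ ^ 2 : ℝ) : ℂ) = ((∑ j, ‖c j‖ ^ 2 : ℝ) : ℂ) := by
    rw [Complex.ofReal_pow, Complex.ofReal_sum]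
    refine h.symm.trans (Finset.sum_congr rfl fun j _ => ?_)
    rw [Complex.conj_mul', ← Complex.ofReal_pow]
  exact_mod_cast h2

variable [CompleteSpace H]

/-- The values at one point of an orthonormal family form a vector of norm at most `‖K‖_∞`. -/
theorem sum_norm_sq_apply_le (hK : BoundedKernel H) {ι : Type*} [Fintype ι] {e : ι → H}
    (he : Orthonormal ℂ e) (x : D) : ∑ j, ‖e j x‖ ^ 2 ≤ kernelSup H ^ 2 := by
  set s : ℝ := ∑ j, ‖e j x‖ ^ 2 with hs
  have hs0 : 0 ≤ s := Finset.sum_nonneg fun j _ => sq_nonneg _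
  set f : H := ∑ j, star (e j x) • e j with hf
  have h1 : f x = (s : ℂ) := by
    rw [hf, sum_coe_apply, hs, Complex.ofReal_sum]
    refine Finset.sum_congr rfl fun j _ => ?_
    rw [Complex.star_def, Complex.conj_mul', ← Complex.ofReal_pow]
  have h2 : ‖f‖ ^ 2 = s := by
    rw [hf, norm_sum_smul_sq he, hs]
    simp only [norm_star]
  have h3 := norm_apply_le_kernelSup hK f x
  rw [h1, Complex.norm_real, Real.norm_of_nonneg hs0] at h3
  have hk := kernelSup_nonneg (H := H)
  rcases hs0.eq_or_lt with h0 | h0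
  · rw [← h0]; positivity
  · have h4 : s ^ 2 ≤ kernelSup H ^ 2 * s := by
      calc s ^ 2 ≤ (kernelSup H * ‖f‖) ^ 2 := pow_le_pow_left₀ hs0 h3 2
        _ = kernelSup H ^ 2 * s := by rw [mul_pow, h2]
    nlinarith

variable [MeasurableSpace D] (ρ : Measure D) [IsProbabilityMeasure ρ]
  (hmeas : ∀ f : H, AEStronglyMeasurable (fun x => f x) ρ) (hK : BoundedKernel H)

theorem norm_embedding_apply_sq (f : H) :
    ‖embedding ρ hmeas hK f‖ ^ 2 = ∫ x, ‖f x‖ ^ 2 ∂ρ := by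
  have h1 : embedding ρ hmeas hK f = (memLp_two ρ hmeas hK f).toLp (fun x => f x) := rfl
  rw [h1, ← @inner_self_eq_norm_sq ℂ, L2.inner_def, ← integral_re (L2.integrable_inner _ _)]
  refine integral_congr_ae ?_
  filter_upwards [(memLp_two ρ hmeas hK f).coeFn_toLp] with x hx
  rw [hx, inner_self_eq_norm_sq]

theorem norm_embedding_le : ‖embedding ρ hmeas hK‖ ≤ kernelSup H :=
  LinearMap.mkContinuous_norm_le _ kernelSup_nonneg _

/-- The tail bound for the discretization error over a finite-dimensional subspace. The constants
do not involve its dimension. -/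
theorem measure_exists_mem_submodule_le (hId : 0 < ‖embedding ρ hmeas hK‖) {t : ℝ} (ht : 0 < t)
    (ht1 : t ≤ 1) {n : ℕ} (hn : 1 ≤ n) (V : Submodule ℂ H) [FiniteDimensional ℂ V] :
    (Measure.pi fun _ : Fin n => ρ) {X | ∃ f ∈ V, t * ‖embedding ρ hmeas hK‖ ^ 2 * ‖f‖ ^ 2 <
        |(∫ x, ‖f x‖ ^ 2 ∂ρ) - (1 / (n : ℝ)) * ∑ i, ‖f (X i)‖ ^ 2|} ≤
      ENNReal.ofReal ((2 : ℝ) ^ (3 / 4 : ℝ) * n *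
        Real.exp (-(n * t ^ 2 * ‖embedding ρ hmeas hK‖ ^ 2 / (21 * kernelSup H ^ 2)))) := by
  set b := stdOrthonormalBasis ℂ V with hb
  set ι := Fin (Module.finrank ℂ V) with hι
  set e : ι → H := fun j => (b j : H) with he
  have heo : Orthonormal ℂ e := b.orthonormal.comp_linearIsometry V.subtypeₗᵢ
  set w : D → ι → ℂ := fun x j => star (e j x) with hw
  have hwB : ∀ x, w x ∈ sqBall ι (kernelSup H ^ 2) := fun x => by
    simpa [sqBall, hw] using sum_norm_sq_apply_le hK heo x
  -- A version of the random vector that is measurable and bounded everywhere.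
  have hwm : AEMeasurable w ρ := aemeasurable_pi_lambda _ fun j =>
    Complex.continuous_conj.measurable.comp_aemeasurable (hmeas (e j)).aemeasurable
  set S := sqBall ι (kernelSup H ^ 2) with hS
  have hSm : MeasurableSet S := (isCompact_sqBall _).isClosed.measurableSet
  set v : D → ι → ℂ := (hwm.mk w ⁻¹' S).indicator (hwm.mk w) with hv
  have hvm : Measurable v := hwm.measurable_mk.indicator (hwm.measurable_mk hSm)
  have hvB : ∀ x, v x ∈ S := fun x => by
    by_cases hx : x ∈ hwm.mk w ⁻¹' S
    · rw [hv, Set.indicator_of_mem hx]; exact hx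
    · rw [hv, Set.indicator_of_notMem hx]
      simp only [hS, sqBall, Set.mem_ofPred_eq, Pi.zero_apply, norm_zero]
      simp only [ne_eq, OfNat.ofNat_ne_zero, not_false_eq_true, zero_pow, Finset.sum_const_zero]
      positivity
  have hvw : ∀ᵐ x ∂ρ, v x = w x := by
    filter_upwards [hwm.ae_eq_mk] with x hx
    rw [hv, Set.indicator_of_mem (by rw [Set.mem_preimage, ← hx]; exact hwB x), hx]
  have hdot : ∀ (c : ι → ℂ) (x : D), ‖star c ⬝ᵥ w x‖ = ‖(∑ j, c j • e j : H) x‖ := fun c x => by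
    rw [sum_coe_apply, ← norm_star (∑ j, c j * e j x), star_sum]
    congr 1
    refine Finset.sum_congr rfl fun j _ => ?_
    rw [star_mul', Pi.star_apply]
  have hmean : ∀ c : ι → ℂ, reTrace (meanOuter ρ v * outer c) =
      ∫ x, ‖(∑ j, c j • e j : H) x‖ ^ 2 ∂ρ := fun c => by
    rw [← integral_reTrace_outer_mul ρ hvm hvB]
    refine integral_congr_ae ?_
    filter_upwards [hvw] with x hx
    rw [reTrace_outer_mul_outer, hx, hdot]
  have hnorm := norm_sum_smul_sq heo
  have hl : ∀ c : ι → ℂ, reTrace (meanOuter ρ v * outer c) ≤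
      ‖embedding ρ hmeas hK‖ ^ 2 * ∑ j, ‖c j‖ ^ 2 := fun c => by
    rw [hmean, ← norm_embedding_apply_sq ρ hmeas hK, ← hnorm, ← mul_pow]
    exact pow_le_pow_left₀ (norm_nonneg _) ((embedding ρ hmeas hK).le_opNorm _) 2
  have hKpos : 0 < kernelSup H := hId.trans_le (norm_embedding_le ρ hmeas hK)
  have hn0 : (0 : ℝ) < n := by exact_mod_cast hn
  have hmain := measureReal_exists_lt_le ρ hvm hvB (pow_pos hId 2) (pow_pos hKpos 2) hl ht ht1 hn
  refine le_trans ?_ (ENNReal.ofReal_le_ofReal hmain)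
  rw [ofReal_measureReal]
  refine measure_mono_ae ?_
  have hall : ∀ᵐ X ∂(Measure.pi fun _ : Fin n => ρ), ∀ i, v (X i) = w (X i) :=
    ae_all_iff.2 fun i => (Measure.quasiMeasurePreserving_eval (fun _ : Fin n => ρ) i).ae hvw
  filter_upwards [hall] with X hX
  rintro ⟨f, hfV, hf⟩
  set c : ι → ℂ := fun j => b.repr ⟨f, hfV⟩ j with hc
  have hfc : (∑ j, c j • e j : H) = f := by
    have h := congrArg (V.subtype) (b.sum_repr ⟨f, hfV⟩)
    simpa [map_sum, hc, he] using h
  refine ⟨c, ?_⟩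
  have htr : reTrace ((centeredSum (meanOuter ρ v) fun i => v (X i)) * outer c) =
      -(n * ((∫ x, ‖f x‖ ^ 2 ∂ρ) - (1 / (n : ℝ)) * ∑ i, ‖f (X i)‖ ^ 2)) := by
    rw [centeredSum, Finset.sum_mul, map_sum]
    have hi : ∀ i, reTrace ((outer (v (X i)) - meanOuter ρ v) * outer c) =
        ‖f (X i)‖ ^ 2 - ∫ x, ‖f x‖ ^ 2 ∂ρ := fun i => by
      rw [sub_mul, map_sub, reTrace_outer_mul_outer, hX i, hdot, hmean, hfc]
    simp only [hi, Finset.sum_sub_distrib, Finset.sum_const, Finset.card_univ, Fintype.card_fin,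
      nsmul_eq_mul]
    field_simp
    ring
  rw [htr, abs_neg, abs_mul, abs_of_pos hn0, ← hnorm c, hfc]
  have := mul_lt_mul_of_pos_left hf hn0
  linarith

/-- The tail bound for the discretization error. Along an increasing sequence of finite-dimensional
subspaces with dense union the bad events increase to the bad event of the whole space. -/
theorem measureReal_lt_discretizationError_le [TopologicalSpace.SeparableSpace H] {t : ℝ}
    (ht : 0 < t) (ht1 : t ≤ 1) {n : ℕ} (hn : 1 ≤ n) :
    (Measure.pi fun _ : Fin n => ρ).real
        {X | t * ‖embedding ρ hmeas hK‖ ^ 2 < discretizationError H ρ X} ≤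
      (2 : ℝ) ^ (3 / 4 : ℝ) * n *
        Real.exp (-(n * t ^ 2 * ‖embedding ρ hmeas hK‖ ^ 2 / (21 * kernelSup H ^ 2))) := by
  -- If the embedding vanishes, the exponent is `0` and the bound is at least `1`.
  rcases (norm_nonneg (embedding ρ hmeas hK)).eq_or_lt with h0 | hId
  · rw [← h0]
    refine measureReal_le_one.trans ?_
    have h1 : (1 : ℝ) ≤ 2 ^ (3 / 4 : ℝ) := Real.one_le_rpow (by norm_num) (by norm_num)
    have h2 : (1 : ℝ) ≤ n := by exact_mod_cast hn
    simpa using one_le_mul_of_one_le_of_one_le h1 h2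
  set a : ℕ → H := TopologicalSpace.denseSeq H with ha
  set V : ℕ → Submodule ℂ H := fun N => Submodule.span ℂ (a '' Set.Iio N) with hV
  have hVmono : Monotone V := fun N M h =>
    Submodule.span_mono (Set.image_mono (Set.Iio_subset_Iio h))
  have hVfin : ∀ N, FiniteDimensional ℂ (V N) := fun N =>
    FiniteDimensional.span_of_finite ℂ ((Set.finite_Iio N).image a)
  set A : ℕ → Set (Fin n → D) := fun N =>
    {X | ∃ f ∈ V N, t * ‖embedding ρ hmeas hK‖ ^ 2 * ‖f‖ ^ 2 <
      |(∫ x, ‖f x‖ ^ 2 ∂ρ) - (1 / (n : ℝ)) * ∑ i, ‖f (X i)‖ ^ 2|} with hA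
  have hAmono : Monotone A := fun N M h X ⟨f, hf, hX⟩ => ⟨f, hVmono h hf, hX⟩
  have hsub : {X | t * ‖embedding ρ hmeas hK‖ ^ 2 < discretizationError H ρ X} ⊆ ⋃ N, A N := by
    intro X hX
    have hX' : t * ‖embedding ρ hmeas hK‖ ^ 2 < discretizationError H ρ X := hX
    rw [discretizationError] at hX'
    have : Nonempty (Metric.closedBall (0 : H) 1) := ⟨⟨0, by simp⟩⟩
    obtain ⟨⟨f, hf1⟩, hf⟩ := exists_lt_of_lt_ciSup hX'
    rw [mem_closedBall_zero_iff] at hf1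
    have hopen : IsOpen {g : H | t * ‖embedding ρ hmeas hK‖ ^ 2 * ‖g‖ ^ 2 <
        |(∫ x, ‖g x‖ ^ 2 ∂ρ) - (1 / (n : ℝ)) * ∑ i, ‖g (X i)‖ ^ 2|} := by
      simp only [← norm_embedding_apply_sq ρ hmeas hK]
      have hem : Continuous (embedding ρ hmeas hK) := (embedding ρ hmeas hK).continuous
      have hev : ∀ i, Continuous fun g : H => g (X i) := fun i => RKHS.continuous_eval (X i)
      have hsum : Continuous fun g : H => ∑ i, ‖g (X i)‖ ^ 2 :=
        continuous_finsetSum _ fun i _ => (hev i).norm.pow 2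
      exact isOpen_lt (continuous_const.mul (continuous_norm.pow 2))
        ((hem.norm.pow 2).sub (continuous_const.mul hsum)).abs
    obtain ⟨k, hg⟩ := (TopologicalSpace.denseRange_denseSeq H).exists_mem_open hopen
      ⟨f, lt_of_le_of_lt (mul_le_of_le_one_right (by positivity)
        (pow_le_one₀ (norm_nonneg f) hf1)) hf⟩
    exact Set.mem_iUnion.2 ⟨k + 1, a k, Submodule.subset_span ⟨k, Nat.lt_succ_self k, rfl⟩, hg⟩
  refine ENNReal.toReal_le_of_le_ofReal (by positivity) ((measure_mono hsub).trans ?_)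
  rw [hAmono.measure_iUnion]
  exact iSup_le fun N => measure_exists_mem_submodule_le ρ hmeas hK hId ht ht1 hn (V N)

omit [IsProbabilityMeasure ρ] in
theorem discretizationError_eq_zero (hK : BoundedKernel H) (h0 : kernelSup H = 0) {n : ℕ}
    (X : Fin n → D) : discretizationError H ρ X = 0 := by
  have h : ∀ (f : H) (x : D), f x = 0 := fun f x => by
    have := norm_apply_le_kernelSup hK f x
    rw [h0, zero_mul] at this
    exact norm_le_zero_iff.1 this
  simp [discretizationError, h]

theorem lt_measureReal_discretizationError_le [TopologicalSpace.SeparableSpace H] {r : ℝ}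
    (hr : 1 < r) {n : ℕ} (hn : 1 ≤ n)
    (hlarge : 21 * r * kernelSup H ^ 2 * Real.log n ≤ n * ‖embedding ρ hmeas hK‖ ^ 2) :
    1 - 2 * (n : ℝ) ^ (1 - r) < (Measure.pi fun _ : Fin n => ρ).real
      {X | discretizationError H ρ X ≤
        ‖embedding ρ hmeas hK‖ * kernelSup H * √(21 * r * Real.log n / n)} := by
  -- For `n = 1` the left-hand side is `-1`.
  rcases hn.eq_or_lt with rfl | hn2
  · refine lt_of_lt_of_le ?_ measureReal_nonneg
    simp
  have hn0 : (0 : ℝ) < n := by exact_mod_cast hn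
  have hlog : 0 < Real.log n := Real.log_pos (by exact_mod_cast hn2)
  have hpow : 0 < (n : ℝ) ^ (1 - r) := Real.rpow_pos_of_pos hn0 _
  have hr0 : 0 < r := zero_lt_one.trans hr
  set L := ‖embedding ρ hmeas hK‖ with hL
  set K := kernelSup H with hKdef
  have hK0 : 0 ≤ K := kernelSup_nonneg
  rcases hK0.eq_or_lt with hKz | hKpos
  · have huniv : {X : Fin n → D | discretizationError H ρ X ≤
        L * K * √(21 * r * Real.log n / n)} = Set.univ := by
      ext X
      simp [discretizationError_eq_zero ρ hK hKz.symm, ← hKz]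
    rw [huniv, probReal_univ]
    linarith
  have hLpos : 0 < L := by
    refine (norm_nonneg _).lt_of_ne' fun h => ?_
    rw [hL, h] at hlarge
    have : 0 < 21 * r * K ^ 2 * Real.log n := by positivity
    simp at hlarge
    linarith
  set q : ℝ := 21 * r * Real.log n / n with hq
  have hq0 : 0 < q := by positivity
  set t : ℝ := K / L * √q with ht
  have ht0 : 0 < t := by positivity
  have htsq : t ^ 2 * L ^ 2 = K ^ 2 * q := by
    rw [ht, mul_pow, Real.sq_sqrt hq0.le]; field_simp
  have ht1 : t ≤ 1 := by
    refine (sq_le_one_iff₀ ht0.le).1 (le_of_mul_le_mul_right ?_ (pow_pos hLpos 2))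
    rw [htsq, one_mul, hq, mul_div_assoc', div_le_iff₀ hn0]
    linarith
  have h := measureReal_lt_discretizationError_le ρ hmeas hK ht0 ht1 hn
  have hthr : t * L ^ 2 = L * K * √q := by rw [ht]; field_simp
  have hexp : n * t ^ 2 * L ^ 2 / (21 * K ^ 2) = r * Real.log n := by
    rw [mul_assoc, htsq, hq]; field_simp
  rw [← hL, ← hKdef, hthr, hexp] at h
  have hbound : (2 : ℝ) ^ (3 / 4 : ℝ) * n * Real.exp (-(r * Real.log n)) =
      (2 : ℝ) ^ (3 / 4 : ℝ) * (n : ℝ) ^ (1 - r) := by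
    rw [mul_assoc, Real.rpow_sub hn0, Real.rpow_one, Real.rpow_def_of_pos hn0 r, Real.exp_neg,
      mul_comm (Real.log n) r, div_eq_mul_inv (n : ℝ)]
  have h2 : (2 : ℝ) ^ (3 / 4 : ℝ) < 2 := by
    simpa using Real.rpow_lt_rpow_of_exponent_lt (x := 2) one_lt_two
      (show (3 / 4 : ℝ) < 1 by norm_num)
  have h3 := mul_lt_mul_of_pos_right h2 hpow
  rw [hbound] at h
  -- Subadditivity of the outer measure replaces the measurability of the event.
  have hcover : (1 : ℝ) ≤ (Measure.pi fun _ : Fin n => ρ).real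
      {X | discretizationError H ρ X ≤ L * K * √q} + (Measure.pi fun _ : Fin n => ρ).real
      {X | L * K * √q < discretizationError H ρ X} := by
    rw [← probReal_univ (μ := Measure.pi fun _ : Fin n => ρ)]
    refine le_trans (measureReal_mono fun X _ => ?_) (measureReal_union_le _ _)
    exact le_or_gt (discretizationError H ρ X) (L * K * √q)
  linarith

end Transfer

end SamplingDiscretization

end

theorem theorem6p1 {d : ℕ} (D : Set (EuclideanSpace ℝ (Fin d))) (hD : MeasurableSet D)
    (ρ : Measure D) [IsProbabilityMeasure ρ]
    (H : Type*) [NormedAddCommGroup H] [InnerProductSpace ℂ H] [CompleteSpace H]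
    [TopologicalSpace.SeparableSpace H] [RKHS ℂ H D ℂ]
    (hmeas : ∀ f : H, AEStronglyMeasurable (fun x => f x) ρ)
    (hK : SamplingDiscretization.BoundedKernel H) :
    (∀ n : ℕ, 1 ≤ n → ∀ t : ℝ, 0 < t → t ≤ 1 →
      (Measure.pi fun _ : Fin n => ρ).real
          {X | t * ‖SamplingDiscretization.embedding ρ hmeas hK‖ ^ 2 <
            SamplingDiscretization.discretizationError H ρ X} ≤
        (2 : ℝ) ^ (3 / 4 : ℝ) * n *
          Real.exp (-(n * t ^ 2 * ‖SamplingDiscretization.embedding ρ hmeas hK‖ ^ 2 /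
            (21 * SamplingDiscretization.kernelSup H ^ 2)))) ∧
    (∀ r : ℝ, 1 < r → ∀ n : ℕ, 1 ≤ n →
      21 * r * SamplingDiscretization.kernelSup H ^ 2 * Real.log n ≤
        n * ‖SamplingDiscretization.embedding ρ hmeas hK‖ ^ 2 →
      1 - 2 * (n : ℝ) ^ (1 - r) <
        (Measure.pi fun _ : Fin n => ρ).real
          {X | SamplingDiscretization.discretizationError H ρ X ≤
            ‖SamplingDiscretization.embedding ρ hmeas hK‖ *
              SamplingDiscretization.kernelSup H * √(21 * r * Real.log n / n)}) :=
  ⟨fun _ hn _ ht ht1 =>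
    SamplingDiscretization.measureReal_lt_discretizationError_le ρ hmeas hK ht ht1 hn,
  fun _ hr _ hn hlarge =>
    SamplingDiscretization.lt_measureReal_discretizationError_le ρ hmeas hK hr hn hlarge⟩
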